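/- Fix $\theta>0$. Let $M(a;c;x)=\sum_{j\ge 0}\frac{(a)_j}{(c)_j}\frac{x^j}{j!}$ be Kummer's function, $(a)_j=a(a+1)\cdots(a+j-1)$, and let $D_a$ denote the derivative with respect to its first parameter. For each integer $k\ge 1$ the equation $$\theta\, D_aM(k;\theta+k;x)-M(k;\theta+k;x)=0$$ has a unique root $\gamma_k$ in $(0,\infty)$, and the roots are strictly increasing: $\gamma_k<\gamma_{k+1}$ for all $k\ge1$. Let $\lambda>0$. Trials arrive at the epochs $0<T_1<T_2<\cdots$ of a homogeneous Poisson process of rate $\lambda$, observed on $[0,1]$. Independently of the epochs and of each other, the $k$-th trial is a success with probability $p_k=\theta/(\theta+k-1)$, $k\ge1$. Let $\mathcal F_t$ be the $\sigma$-algebra generated by the epochs and outcomes of the trials in $[0,t]$. A stopping strategy is an $(\mathcal F_t)$-stopping time with values in $\{T_1,\dots,T_N,1\}$, where $N$ is the number of arrivals in $[0,1]$ and the value $1$ means not stopping. A strategy wins if it stops before time $1$ at a trial that is a success and no further success occurs before time $1$; it is optimal if its winning probability is maximal among all strategies. With $\pi_n=e^{-\lambda}\lambda^n/n!$, let $$\mathcal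 S_i(t,k)=\sum_{j\ge0}\frac{\binom{k+j}{k}\pi_{k+j}(1-t)^j}{\sum_{n\ge k}\binom nk\pi_n(1-t)^{n-k}}\;s_i(k+1,k+j),\qquad i=0,1,$$ where $s_0(k,n)=\prod_{j=k}^n(1-p_j)$ and $s_1(k,n)=s_0(k,n)\sum_{j=k}^n\frac{p_j}{1-p_j}$; these are the probabilities that no success, respectively exactly one success, follows after time $t$ when $k$ trials have arrived by time $t$. The myopic strategy $\tau^*$ stops at the first success, at time $t<1$ and with index $k$, such that $\mathcal S_1(t,k)\le\mathcal S_0(t,k)$. Then for $t\in[0,1]$ and $k\ge1$ one has $\mathcal S_1(t,k)\le\mathcal S_0(t,k)$ if and only if $(1-t)\lambda\le\gamma_k$. Hence $\tau^*$ is the rule that stops at the first success, at time $t<1$ and with index $k$, for which $(1-t)\lambda\le\gamma_k$, and this rule is optimal. -/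

import Mathlib

open MeasureTheory ProbabilityTheory

noncomputable section

namespace LastSuccess

/-! ### Kummer's function and the critical roots -/

/-- Kummer's confluent hypergeometric function
`M(a, c, x) = ∑ j, (a)_j / (c)_j * x ^ j / j!`, with `(a)_j` the rising factorial. -/
def kummerM (a c x : ℝ) : ℝ :=
  ∑' j : ℕ, (ascPochhammer ℝ j).eval a / (ascPochhammer ℝ j).eval c * (x ^ j / (j.factorial : ℝ))

/-- `x > 0` solves `θ * D_a M(k; θ + k; x) - M(k; θ + k; x) = 0`, where `D_a` is the derivative in
the first parameter only (the second parameter is held fixed at `θ + k`). -/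
def IsCriticalRoot (θ : ℝ) (k : ℕ) (x : ℝ) : Prop :=
  0 < x ∧ θ * deriv (fun a : ℝ => kummerM a (θ + k) x) k - kummerM k (θ + k) x = 0

/-! ### Success profile, prior, and the adapted rewards -/

/-- The Karamata-Stirling profile `p_k = θ / (θ + k - 1)`, for trial indices `k ≥ 1`. -/
def ksProfile (θ : ℝ) (k : ℕ) : ℝ := θ / (θ + k - 1)

/-- The Poisson prior `π_n = λ ^ n / n! * exp (-λ)` on the number of trials. -/
def poissonPrior (lam : ℝ) (n : ℕ) : ℝ := lam ^ n / (n.factorial : ℝ) * Real.exp (-lam)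

/-- Probability of no success among the trials `k, …, n` (equal to `1` if `n < k`). -/
def s0 (p : ℕ → ℝ) (k n : ℕ) : ℝ := ∏ j ∈ Finset.Icc k n, (1 - p j)

/-- Probability of exactly one success among the trials `k, …, n` (equal to `0` if `n < k`). -/
def s1 (p : ℕ → ℝ) (k n : ℕ) : ℝ := s0 p k n * ∑ j ∈ Finset.Icc k n, p j / (1 - p j)

/-- The posterior probability `P(N = k + j | N_t = k)` of `j` further trials in `(t, 1]`, for the
prior `prior` on the number `N` of trials, arriving at independent uniform times in `[0, 1]`. -/
def posterior (prior : ℕ → ℝ) (t : ℝ) (k j : ℕ) : ℝ :=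
  ((k + j).choose k * prior (k + j) * (1 - t) ^ j) /
    ∑' i : ℕ, (k + i).choose k * prior (k + i) * (1 - t) ^ i

/-- Probability `S₀(t, k)` that no success follows the state `(t, k)`: the reward from stopping
at a success state `(t, k)`. -/
def S0 (prior p : ℕ → ℝ) (t : ℝ) (k : ℕ) : ℝ :=
  ∑' j : ℕ, posterior prior t k j * s0 p (k + 1) (k + j)

/-- Probability `S₁(t, k)` that exactly one success follows the state `(t, k)`: the reward from
stopping at the next success after `(t, k)`. -/
def S1 (prior p : ℕ → ℝ) (t : ℝ) (k : ℕ) : ℝ :=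
  ∑' j : ℕ, posterior prior t k j * s1 p (k + 1) (k + j)

/-! ### The marked Poisson process and the stopping problem -/

variable {Ω : Type*} [mΩ : MeasurableSpace Ω]

/-- A homogeneous Poisson process of rate `lam` with arrival epochs `0 = T 0 < T 1 < T 2 < …`
(so `T k` is the `k`-th epoch for `k ≥ 1`, and `T 0` is only the time origin), whose `k`-th arrival,
`k ≥ 1`, carries the mark `X k` (`true` means success). The interarrival times are independent and
exponential of rate `lam`; the marks are independent of each other and of the epochs, and
`P(X k = true) = p k`. Only the arrivals in `[0, 1]` matter for the stopping problem. -/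
structure IsMarkedPoisson (P : Measure Ω) (lam : ℝ) (p : ℕ → ℝ)
    (T : ℕ → Ω → ℝ) (X : ℕ → Ω → Bool) : Prop where
  measurable_T : ∀ n, Measurable (T n)
  measurable_X : ∀ n, Measurable (X n)
  T_zero : ∀ ω, T 0 ω = 0
  strictMono_T : ∀ ω, StrictMono fun n => T n ω
  gap_law : ∀ n, P.map (fun ω => T (n + 1) ω - T n ω) = expMeasure lam
  gap_indep : iIndepFun (fun (n : ℕ) ω => T (n + 1) ω - T n ω) P
  mark_law : ∀ n, 1 ≤ n → P.real {ω | X n ω = true} = p n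
  mark_indep : iIndepFun (fun (n : ℕ) => X (n + 1)) P
  epochs_indep_marks :
    IndepFun (fun ω (n : ℕ) => T (n + 1) ω) (fun ω (n : ℕ) => X (n + 1) ω) P

/-- The natural filtration: `F t` is generated by the epochs and marks of the arrivals in
`[0, t]`, that is, by the events `{T n ≤ s}` and `{T n ≤ s, X n = true}` for `n ≥ 1`, `s ≤ t`. -/
def arrivalFiltration (T : ℕ → Ω → ℝ) (X : ℕ → Ω → Bool)
    (hT : ∀ n, Measurable (T n)) (hX : ∀ n, Measurable (X n)) : Filtration ℝ mΩ where
  seq t := MeasurableSpace.generateFrom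
    {A | ∃ n : ℕ, 1 ≤ n ∧ ∃ s : ℝ, s ≤ t ∧
      (A = {ω | T n ω ≤ s} ∨ A = {ω | T n ω ≤ s ∧ X n ω = true})}
  mono' := by
    intro t t' htt'
    apply MeasurableSpace.generateFrom_mono
    rintro A ⟨n, hn, s, hs, hA⟩
    exact ⟨n, hn, s, hs.trans htt', hA⟩
  le' := by
    intro t
    apply MeasurableSpace.generateFrom_le
    rintro A ⟨n, -, s, -, rfl | rfl⟩
    · exact measurableSet_le (hT n) measurable_const
    · exact (measurableSet_le (hT n) measurable_const).inter
        (hX n (measurableSet_singleton true))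

/-- A stopping strategy: a stopping time of the natural filtration with values in
`{T 1, …, T N, 1}`, where `N` is the number of arrivals in `[0, 1]`; the value `1` means not
stopping at all. -/
def IsStrategy (T : ℕ → Ω → ℝ) (X : ℕ → Ω → Bool)
    (hT : ∀ n, Measurable (T n)) (hX : ∀ n, Measurable (X n)) (τ : Ω → ℝ) : Prop :=
  IsStoppingTime (arrivalFiltration T X hT hX) (fun ω => (τ ω : WithTop ℝ)) ∧
    ∀ ω, τ ω = 1 ∨ ∃ k : ℕ, 1 ≤ k ∧ T k ω ≤ 1 ∧ τ ω = T k ω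

/-- The event that `τ` stops (before time `1`) at a success and no success occurs after `τ` and
before time `1`: the last success has been selected. -/
def winEvent (T : ℕ → Ω → ℝ) (X : ℕ → Ω → Bool) (τ : Ω → ℝ) : Set Ω :=
  {ω | ∃ k : ℕ, 1 ≤ k ∧ T k ω < 1 ∧ τ ω = T k ω ∧ X k ω = true ∧
    ∀ n : ℕ, 1 ≤ n → τ ω < T n ω → T n ω < 1 → X n ω = false}

/-- `τ` is a strategy whose winning probability is maximal among all strategies. -/
def IsOptimal (P : Measure Ω) (T : ℕ → Ω → ℝ) (X : ℕ → Ω → Bool)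
    (hT : ∀ n, Measurable (T n)) (hX : ∀ n, Measurable (X n)) (τ : Ω → ℝ) : Prop :=
  IsStrategy T X hT hX τ ∧
    ∀ σ : Ω → ℝ, IsStrategy T X hT hX σ → P (winEvent T X σ) ≤ P (winEvent T X τ)

open Classical in
/-- The Markovian rule with stopping set `A`: stop at the first success, at time `t < 1` and with
index `k`, such that `(t, k) ∈ A`; if there is none, do not stop (value `1`). -/
def markovRule (T : ℕ → Ω → ℝ) (X : ℕ → Ω → Bool) (A : Set (ℝ × ℕ)) (ω : Ω) : ℝ :=
  if ∃ k : ℕ, 1 ≤ k ∧ T k ω < 1 ∧ X k ω = true ∧ (T k ω, k) ∈ A then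
    T (sInf {k : ℕ | 1 ≤ k ∧ T k ω < 1 ∧ X k ω = true ∧ (T k ω, k) ∈ A}) ω
  else 1

/-- The stopping set of the myopic strategy: the states with `S₁(t, k) ≤ S₀(t, k)`. -/
def myopicSet (prior p : ℕ → ℝ) : Set (ℝ × ℕ) :=
  {q | S1 prior p q.1 q.2 ≤ S0 prior p q.1 q.2}

end LastSuccess

end

/-!
The last-success problem with success profile `θ / (θ + k - 1)` and Poisson arrivals is in the
monotone case of optimal stopping, so that the one-step look-ahead rule is optimal.

**The thresholds.** With `x = (1 - t) * lam` remaining arrivals expected, the rewards are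
`S₀ = exp (-x) * M` and `S₁ = θ * exp (-x) * D_a M`, where `M = M(k, θ + k, x)` (`S0_eq`, `S1_eq`).
So `S₁ ≤ S₀` means `D_a M / M ≤ 1 / θ`. Both monotonicity properties of this quotient come from
Kummer's equation `x M'' + (c - x) M' - k M = 0`, `c = θ + k`, and from its derivative in the first
parameter, `x N'' + (c - x) N' - k N = M` for `N = D_a M`:
* the Wronskian `V = N' M - N M'` satisfies `x V' + (c - x) V = M²`, whence `V > 0` and `N / M`
  increases in `x` (`wronskian_pos`); together with the divergence of the harmonic series this gives
  the unique root `γ k`;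
* `W = k V - M' M` satisfies `x W' + (c - x) W = - x M'²`, whence `W < 0`; by the contiguity
  relations `W` is a positive multiple of `N_{k+1} M_k - N_k M_{k+1}`, so `N / M` decreases from `k`
  to `k + 1` (`kumN_succ_mul_lt`) and `γ k < γ (k + 1)`.

**Optimality.** Let `ℓ` be the last success before time `1` and `i` the one before it. A strategy
wins exactly if it has not stopped at a success up to `i` but has stopped at a success up to `ℓ`.
Summing over the possible values of `i` and `ℓ` gives, for every strategy `σ`,
`P(σ wins) = P(exactly one success) + ∑ k, E[S₁ - S₀; k is a success that σ passes]`
(`IsMarkedPoisson.measure_winEvent_add`, stated without subtraction). Here the conditional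
probabilities given the past of the `k`-th arrival may be inserted because passing `k` is an event
of that past (`IsMarkedPoisson.measurableSet_passedSuccess`). The `k`-th term is largest if `σ`
passes exactly the successes with `S₁ > S₀`. As the thresholds increase, the states with `S₁ ≤ S₀`
are never left again, so the threshold rule does precisely this for all `k` at once
(`passedSuccess_markovRule`, `IsMarkedPoisson.gain_le`).

The conditional probabilities are computed from two independence statements: an interarrival time is
independent of the earlier epochs and all marks, which yields the Poisson law of the number of
further arrivals (`IsMarkedPoisson.measure_inter_lastArrival`), and the later marks are independent
of the past (`IsMarkedPoisson.measure_inter_of_futureMarks`).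
-/

namespace LastSuccess

/-! ### Exponential generating functions -/

/-- The exponential generating function `∑ a_j x ^ j / j!` of a real sequence. -/
noncomputable def egf (a : ℕ → ℝ) (x : ℝ) : ℝ := ∑' j : ℕ, a j * (x ^ j / (j.factorial : ℝ))

/-- The sequence `a` grows at most geometrically, so that its exponential generating function is
entire. -/
def GeomBdd (a : ℕ → ℝ) : Prop := ∃ C B : ℝ, 0 ≤ C ∧ 0 ≤ B ∧ ∀ j, |a j| ≤ C * B ^ j

lemma GeomBdd.shift {a : ℕ → ℝ} (h : GeomBdd a) : GeomBdd fun j => a (j + 1) := by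
  obtain ⟨C, B, hC, hB, h⟩ := h
  refine ⟨C * B, B, by positivity, hB, fun j => (h (j + 1)).trans_eq (by ring)⟩

lemma GeomBdd.nat_mul {a : ℕ → ℝ} (h : GeomBdd a) : GeomBdd fun j => (j : ℝ) * a j := by
  obtain ⟨C, B, hC, hB, h⟩ := h
  refine ⟨C, 2 * B, hC, by positivity, fun j => ?_⟩
  have h2 : (j : ℝ) ≤ 2 ^ j := by exact_mod_cast (Nat.lt_two_pow_self (n := j)).le
  rw [abs_mul, Nat.abs_cast, mul_pow]
  calc (j : ℝ) * |a j| ≤ 2 ^ j * (C * B ^ j) := by gcongr; exact h j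
    _ = _ := by ring

lemma GeomBdd.add {a b : ℕ → ℝ} (ha : GeomBdd a) (hb : GeomBdd b) :
    GeomBdd fun j => a j + b j := by
  obtain ⟨C, B, hC, hB, h⟩ := ha
  obtain ⟨C', B', hC', hB', h'⟩ := hb
  refine ⟨C + C', max B B', by positivity, by positivity, fun j => (abs_add_le _ _).trans ?_⟩
  rw [add_mul]
  gcongr
  · exact (h j).trans (by gcongr; exact le_max_left _ _)
  · exact (h' j).trans (by gcongr; exact le_max_right _ _)

lemma GeomBdd.const_mul {a : ℕ → ℝ} (ha : GeomBdd a) (c : ℝ) : GeomBdd fun j => c * a j := by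
  obtain ⟨C, B, hC, hB, h⟩ := ha
  refine ⟨|c| * C, B, by positivity, by positivity, fun j => ?_⟩
  rw [abs_mul, mul_assoc]
  gcongr
  exact h j

lemma GeomBdd.summable {a : ℕ → ℝ} (ha : GeomBdd a) (x : ℝ) :
    Summable fun j : ℕ => a j * (x ^ j / (j.factorial : ℝ)) := by
  obtain ⟨C, B, hC, hB, h⟩ := ha
  refine Summable.of_norm_bounded ((Real.summable_pow_div_factorial (B * |x|)).mul_left C)
    fun j => ?_
  rw [norm_mul, norm_div, norm_pow, Real.norm_eq_abs, Real.norm_eq_abs, Real.norm_eq_abs,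
    Nat.abs_cast, mul_pow]
  calc |a j| * (|x| ^ j / j.factorial) ≤ C * B ^ j * (|x| ^ j / j.factorial) := by
        gcongr; exact h j
    _ = _ := by ring

lemma egf_zero (a : ℕ → ℝ) : egf a 0 = a 0 := by
  rw [egf, tsum_eq_single 0]
  · simp
  · intro j hj; simp [hj]

lemma egf_add {a b : ℕ → ℝ} (ha : GeomBdd a) (hb : GeomBdd b) (x : ℝ) :
    egf (fun j => a j + b j) x = egf a x + egf b x := by
  simp only [egf, add_mul]
  exact (ha.summable x).tsum_add (hb.summable x)

lemma egf_const_mul (a : ℕ → ℝ) (c x : ℝ) : egf (fun j => c * a j) x = c * egf a x := by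
  simp only [egf, mul_assoc]
  exact tsum_mul_left

/-- Differentiating an exponential generating function shifts its coefficients. -/
lemma hasDerivAt_egf {a : ℕ → ℝ} (ha : GeomBdd a) (x : ℝ) :
    HasDerivAt (egf a) (egf (fun j => a (j + 1)) x) x := by
  obtain ⟨C, B, hC, hB, h⟩ := id ha
  set R : ℝ := |x| + 1
  have hR : 0 ≤ R := by positivity
  have fac : ∀ j : ℕ, ((j + 1).factorial : ℝ) = (j + 1) * j.factorial := fun j => by
    push_cast [Nat.factorial_succ]; ring
  have hu : Summable fun j : ℕ => C * B ^ j * (j * R ^ (j - 1) / (j.factorial : ℝ)) := by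
    refine (summable_nat_add_iff 1).1 (((Real.summable_pow_div_factorial (B * R)).mul_left
      (C * B)).congr fun j => ?_)
    have : (j.factorial : ℝ) ≠ 0 := by positivity
    rw [fac, Nat.add_sub_cancel, mul_pow]
    push_cast
    field_simp
    ring
  have key := hasDerivAt_tsum_of_isPreconnected (𝕜 := ℝ) (t := Metric.ball (0 : ℝ) R) (y := x)
    (y₀ := x) (g := fun (j : ℕ) y => a j * (y ^ j / (j.factorial : ℝ)))
    (g' := fun (j : ℕ) y => a j * (j * y ^ (j - 1) / (j.factorial : ℝ))) hu Metric.isOpen_ball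
    (convex_ball _ _).isPreconnected
    (fun j y _ => ((hasDerivAt_pow j y).div_const _).const_mul _) (fun j y hy => ?_)
    (by simp [R]) (ha.summable x) (by simp [R])
  · have hs : Summable fun j : ℕ => a j * (j * x ^ (j - 1) / (j.factorial : ℝ)) := by
      refine (summable_nat_add_iff 1).1 ((ha.shift.summable x).congr fun j => ?_)
      have : (j.factorial : ℝ) ≠ 0 := by positivity
      rw [fac, Nat.add_sub_cancel]
      push_cast
      field_simp
    have hE : egf (fun j => a (j + 1)) x =
        ∑' j : ℕ, a j * (j * x ^ (j - 1) / (j.factorial : ℝ)) := by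
      rw [hs.tsum_eq_zero_add, egf]
      simp only [Nat.cast_zero, zero_mul, zero_div, mul_zero, zero_add]
      refine tsum_congr fun j => ?_
      have : (j.factorial : ℝ) ≠ 0 := by positivity
      rw [fac, Nat.add_sub_cancel]
      push_cast
      field_simp
    rw [hE]
    exact key
  · rw [mem_ball_zero_iff, Real.norm_eq_abs] at hy
    rw [norm_mul, norm_div, norm_mul, norm_pow, Real.norm_eq_abs, Real.norm_eq_abs,
      Real.norm_eq_abs, Real.norm_eq_abs, Nat.abs_cast, Nat.abs_cast]
    gcongr
    exact h j

/-- Multiplying the derivative by `x` multiplies the coefficients by their index. -/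
lemma mul_egf_shift {a : ℕ → ℝ} (ha : GeomBdd a) (x : ℝ) :
    x * egf (fun j => a (j + 1)) x = egf (fun j => j * a j) x := by
  rw [egf, egf, (ha.nat_mul.summable x).tsum_eq_zero_add, ← tsum_mul_left]
  simp only [Nat.cast_zero, zero_mul, zero_add]
  refine tsum_congr fun j => ?_
  have : (j.factorial : ℝ) ≠ 0 := by positivity
  push_cast [Nat.factorial_succ]
  field_simp
  ring

/-- Kummer's differential equation `x f'' + (c - x) f' - k f = g` in terms of coefficients. -/
lemma kummer_ode {a b : ℕ → ℝ} (ha : GeomBdd a) {c k : ℝ}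
    (hab : ∀ j : ℕ, (c + j) * a (j + 1) - (k + j) * a j = b j) (x : ℝ) :
    x * egf (fun j => a (j + 2)) x + (c - x) * egf (fun j => a (j + 1)) x - k * egf a x =
      egf b x := by
  have e1 := mul_egf_shift ha.shift x
  have e2 := mul_egf_shift ha x
  have hb : b = fun j => ((j * a (j + 1) + c * a (j + 1)) + (-1 : ℝ) * (j * a j)) + (-k) * a j :=
    funext fun j => by rw [← hab]; ring
  have g1 := ha.shift.nat_mul
  have g2 := ha.shift.const_mul c
  have g3 := ha.nat_mul.const_mul (-1)
  rw [hb, egf_add ((g1.add g2).add g3) (ha.const_mul _), egf_add (g1.add g2) g3, egf_add g1 g2,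
    egf_const_mul, egf_const_mul, egf_const_mul, ← e1, ← e2]
  ring

/-! ### The reward series -/

/-- The coefficient `(k)_j / (θ + k)_j`: the probability that trials `k + 1, …, k + j` are all
failures. -/
noncomputable def failCoeff (θ : ℝ) (k j : ℕ) : ℝ :=
  ∏ i ∈ Finset.range j, ((k + i : ℝ) / (θ + k + i))

/-- The shifted harmonic sum `∑_{i < j} 1 / (k + i)`, the logarithmic derivative of `(a)_j` at
`a = k`. -/
noncomputable def shiftHarm (k j : ℕ) : ℝ := ∑ i ∈ Finset.range j, (1 / (k + i : ℝ))

/-- The function `M(k, θ + k, x)`. -/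
noncomputable def kumM (θ : ℝ) (k : ℕ) : ℝ → ℝ := egf (failCoeff θ k)

/-- The function `D_a M(k, θ + k, x)`. -/
noncomputable def kumN (θ : ℝ) (k : ℕ) : ℝ → ℝ := egf fun j => failCoeff θ k j * shiftHarm k j

section
variable {θ : ℝ} {k : ℕ}

lemma failCoeff_pos (hθ : 0 < θ) (hk : 1 ≤ k) (j : ℕ) : 0 < failCoeff θ k j := by
  have : (0 : ℝ) < k := by exact_mod_cast hk
  exact Finset.prod_pos fun i _ => by positivity

lemma failCoeff_le_one (hθ : 0 < θ) (hk : 1 ≤ k) (j : ℕ) : failCoeff θ k j ≤ 1 := by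
  have : (0 : ℝ) < k := by exact_mod_cast hk
  refine Finset.prod_le_one (fun i _ => by positivity) fun i _ => ?_
  rw [div_le_one (by positivity)]
  linarith

lemma shiftHarm_nonneg (k j : ℕ) : 0 ≤ shiftHarm k j := Finset.sum_nonneg fun i _ => by positivity

lemma shiftHarm_le (hk : 1 ≤ k) (j : ℕ) : shiftHarm k j ≤ j := by
  have h1 : (1 : ℝ) ≤ k := by exact_mod_cast hk
  calc shiftHarm k j ≤ ∑ i ∈ Finset.range j, (1 : ℝ) := Finset.sum_le_sum fun i _ => by
        rw [div_le_one (by positivity)]; linarith [(Nat.cast_nonneg i : (0 : ℝ) ≤ i)]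
    _ = j := by simp

lemma geomBdd_failCoeff (hθ : 0 < θ) (hk : 1 ≤ k) : GeomBdd (failCoeff θ k) :=
  ⟨1, 1, zero_le_one, zero_le_one, fun j => by
    rw [abs_of_pos (failCoeff_pos hθ hk j)]; simpa using failCoeff_le_one hθ hk j⟩

lemma geomBdd_failCoeff_mul (hθ : 0 < θ) (hk : 1 ≤ k) :
    GeomBdd fun j => failCoeff θ k j * shiftHarm k j := by
  obtain ⟨C, B, hC, hB, h⟩ := (geomBdd_failCoeff hθ hk).nat_mul
  refine ⟨C, B, hC, hB, fun j => le_trans ?_ (h j)⟩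
  have h1 := failCoeff_pos hθ hk j
  rw [abs_mul, abs_mul, abs_of_nonneg (shiftHarm_nonneg k j), Nat.abs_cast, mul_comm (j : ℝ)]
  gcongr
  exact shiftHarm_le hk j

lemma failCoeff_succ (hθ : 0 < θ) (j : ℕ) :
    (θ + k + j) * failCoeff θ k (j + 1) = (k + j) * failCoeff θ k j := by
  rw [failCoeff, Finset.prod_range_succ, ← failCoeff]
  have : (θ + k + j : ℝ) ≠ 0 := by positivity
  field_simp

lemma failCoeff_succ' (j : ℕ) :
    failCoeff θ k (j + 1) = k / (θ + k) * failCoeff θ (k + 1) j := by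
  rw [failCoeff, Finset.prod_range_succ', failCoeff, mul_comm]
  congr 1
  · simp
  · refine Finset.prod_congr rfl fun i _ => ?_
    push_cast
    congr 1 <;> ring

lemma shiftHarm_succ' (j : ℕ) : shiftHarm k (j + 1) = 1 / k + shiftHarm (k + 1) j := by
  rw [shiftHarm, Finset.sum_range_succ', shiftHarm, add_comm]
  congr 1
  · simp
  · refine Finset.sum_congr rfl fun i _ => ?_
    push_cast
    congr 1; ring

lemma hasDerivAt_kumM (hθ : 0 < θ) (hk : 1 ≤ k) (x : ℝ) :
    HasDerivAt (kumM θ k) (k / (θ + k) * kumM θ (k + 1) x) x := by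
  have h := hasDerivAt_egf (geomBdd_failCoeff hθ hk) x
  simp only [failCoeff_succ', egf_const_mul] at h
  exact h

lemma egf_shift_failCoeff_mul (hθ : 0 < θ) (hk : 1 ≤ k) (x : ℝ) :
    egf (fun j => failCoeff θ k (j + 1) * shiftHarm k (j + 1)) x =
      1 / (θ + k) * kumM θ (k + 1) x + k / (θ + k) * kumN θ (k + 1) x := by
  have hk0 : (k : ℝ) ≠ 0 := by exact_mod_cast (by omega : k ≠ 0)
  have h0 : (θ + k : ℝ) ≠ 0 := by positivity
  rw [kumM, kumN, ← egf_const_mul, ← egf_const_mul,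
    ← egf_add ((geomBdd_failCoeff hθ (by omega)).const_mul _)
      ((geomBdd_failCoeff_mul hθ (by omega)).const_mul _)]
  congr 1
  ext j
  rw [failCoeff_succ', shiftHarm_succ']
  field_simp

lemma hasDerivAt_kumN (hθ : 0 < θ) (hk : 1 ≤ k) (x : ℝ) :
    HasDerivAt (kumN θ k)
      (1 / (θ + k) * kumM θ (k + 1) x + k / (θ + k) * kumN θ (k + 1) x) x := by
  rw [← egf_shift_failCoeff_mul hθ hk]
  exact hasDerivAt_egf (geomBdd_failCoeff_mul hθ hk) x

lemma kumM_pos (hθ : 0 < θ) (hk : 1 ≤ k) {x : ℝ} (hx : 0 ≤ x) : 0 < kumM θ k x := by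
  refine ((geomBdd_failCoeff hθ hk).summable x).tsum_pos (fun j => ?_) 0 ?_
  · have := failCoeff_pos hθ hk j; positivity
  · have := failCoeff_pos hθ hk 0; simpa

/-! ### Monotonicity of `D_a M / M` and its consequences for the roots -/

/-- If `f` solves `x f' + (c - x) f = g` with `g > 0`, then `f > 0` on `(0, ∞)`: the integrating
factor `x ^ c * exp (-x)` turns the equation into `(x ^ c * exp (-x) * f)' > 0`. -/
lemma pos_of_kummer_first_order {f f' : ℝ → ℝ} {c : ℝ} (hc : 0 < c)
    (hf : ∀ x, HasDerivAt f (f' x) x) (h : ∀ x, 0 < x → 0 < x * f' x + (c - x) * f x) {x : ℝ}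
    (hx : 0 < x) : 0 < f x := by
  have hfc : Continuous f := continuous_iff_continuousAt.2 fun x => (hf x).continuousAt
  have hmono : StrictMonoOn (fun x : ℝ => x ^ c * Real.exp (-x) * f x) (Set.Ici 0) := by
    refine strictMonoOn_of_deriv_pos (convex_Ici 0) ?_ fun y hy => ?_
    · have : Continuous fun x : ℝ => x ^ c := Real.continuous_rpow_const hc.le
      fun_prop
    · rw [interior_Ici, Set.mem_Ioi] at hy
      have hd := ((Real.hasDerivAt_rpow_const (p := c) (Or.inl hy.ne')).mul
        (hasDerivAt_neg y).exp).mul (hf y)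
      have hd' : HasDerivAt (fun x : ℝ => x ^ c * Real.exp (-x) * f x)
          (y ^ (c - 1) * Real.exp (-y) * (y * f' y + (c - y) * f y)) y := by
        have e : y ^ c = y ^ (c - 1) * y := by
          rw [← Real.rpow_add_one hy.ne', sub_add_cancel]
        refine hd.congr_deriv ?_
        simp only [Pi.mul_apply, e]
        ring
      rw [hd'.deriv]
      have := h y hy
      positivity
  have h0 := hmono (Set.mem_Ici.2 le_rfl) (Set.mem_Ici.2 hx.le) hx
  simp only [Real.zero_rpow hc.ne', zero_mul] at h0
  have h1 : 0 < x ^ c * Real.exp (-x) := by positivity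
  exact (pos_iff_pos_of_mul_pos h0).1 h1

lemma kumM_ode (hθ : 0 < θ) (hk : 1 ≤ k) (x : ℝ) :
    x * egf (fun j => failCoeff θ k (j + 2)) x
      + (θ + k - x) * egf (fun j => failCoeff θ k (j + 1)) x - k * kumM θ k x = 0 := by
  have h := kummer_ode (c := θ + k) (k := k) (b := fun j => 0 * failCoeff θ k j)
    (geomBdd_failCoeff hθ hk) (fun j => by rw [failCoeff_succ hθ]; ring) x
  rwa [egf_const_mul, zero_mul] at h

lemma kumN_ode (hθ : 0 < θ) (hk : 1 ≤ k) (x : ℝ) :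
    x * egf (fun j => failCoeff θ k (j + 2) * shiftHarm k (j + 2)) x
      + (θ + k - x) * egf (fun j => failCoeff θ k (j + 1) * shiftHarm k (j + 1)) x
      - k * kumN θ k x = kumM θ k x := by
  refine kummer_ode (geomBdd_failCoeff_mul hθ hk) (fun j => ?_) x
  rw [← mul_assoc, failCoeff_succ hθ, shiftHarm, Finset.sum_range_succ, ← shiftHarm]
  have : (1 : ℝ) ≤ k := by exact_mod_cast hk
  field_simp
  ring

/-- The Wronskian of `M` and `D_a M` is positive, so that `D_a M / M` increases in `x`. -/
lemma wronskian_pos (hθ : 0 < θ) (hk : 1 ≤ k) {x : ℝ} (hx : 0 < x) :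
    0 < egf (fun j => failCoeff θ k (j + 1) * shiftHarm k (j + 1)) x * kumM θ k x
      - kumN θ k x * egf (fun j => failCoeff θ k (j + 1)) x := by
  have gM := geomBdd_failCoeff hθ hk
  have gN := geomBdd_failCoeff_mul hθ hk
  refine pos_of_kummer_first_order (c := θ + k) (by positivity)
    (fun y => ((hasDerivAt_egf gN.shift y).mul (hasDerivAt_egf gM y)).sub
      ((hasDerivAt_egf gN y).mul (hasDerivAt_egf gM.shift y))) (fun y hy => ?_) hx
  have e1 := kumM_ode hθ hk y
  have e2 := kumN_ode hθ hk y
  have h0 := kumM_pos hθ hk hy.le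
  have : 0 < kumM θ k y ^ 2 := by positivity
  refine this.trans_eq ?_
  simp only [kumM, kumN, Pi.mul_apply, Pi.sub_apply] at *
  linear_combination egf (fun j => failCoeff θ k j * shiftHarm k j) y * e1
    - egf (failCoeff θ k) y * e2

/-- The function `k (N' M - N M') - M' M`, with `M` the Kummer function and `N` its derivative in
the first parameter, is negative. By the contiguity relations it is a positive multiple of the
cross difference of `N` and `M` at `k` and `k + 1`, so `D_a M / M` decreases from `k` to `k + 1`. -/
lemma kumN_succ_mul_lt (hθ : 0 < θ) (hk : 1 ≤ k) {x : ℝ} (hx : 0 < x) :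
    kumN θ (k + 1) x * kumM θ k x < kumN θ k x * kumM θ (k + 1) x := by
  have gM := geomBdd_failCoeff hθ hk
  have gN := geomBdd_failCoeff_mul hθ hk
  have hk0 : (0 : ℝ) < k := by exact_mod_cast hk
  have key : 0 < egf (fun j => failCoeff θ k (j + 1)) x * kumM θ k x -
      k * (egf (fun j => failCoeff θ k (j + 1) * shiftHarm k (j + 1)) x * kumM θ k x
      - kumN θ k x * egf (fun j => failCoeff θ k (j + 1)) x) := by
    refine pos_of_kummer_first_order (c := θ + k) (by positivity)
      (fun y => ((hasDerivAt_egf gM.shift y).mul (hasDerivAt_egf gM y)).sub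
        ((((hasDerivAt_egf gN.shift y).mul (hasDerivAt_egf gM y)).sub
        ((hasDerivAt_egf gN y).mul (hasDerivAt_egf gM.shift y))).const_mul _)) (fun y hy => ?_) hx
    have e1 := kumM_ode hθ hk y
    have e2 := kumN_ode hθ hk y
    have h0 : 0 < egf (fun j => failCoeff θ k (j + 1)) y := by
      simp only [failCoeff_succ', egf_const_mul]
      have := kumM_pos hθ (k := k + 1) (by omega) hy.le
      rw [kumM] at this
      positivity
    have : 0 < y * egf (fun j => failCoeff θ k (j + 1)) y ^ 2 := by positivity
    refine this.trans_eq ?_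
    simp only [kumM, kumN, Pi.mul_apply, Pi.sub_apply] at *
    linear_combination (- egf (failCoeff θ k) y
      - k * egf (fun j => failCoeff θ k j * shiftHarm k j) y) * e1
      + k * egf (failCoeff θ k) y * e2
  rw [egf_shift_failCoeff_mul hθ hk] at key
  simp only [failCoeff_succ', egf_const_mul] at key
  change 0 < k / (θ + k) * kumM θ (k + 1) x * kumM θ k x - k * ((1 / (θ + k) * kumM θ (k + 1) x +
    k / (θ + k) * kumN θ (k + 1) x) * kumM θ k x -
      kumN θ k x * (k / (θ + k) * kumM θ (k + 1) x)) at key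
  have e : k / (θ + k) * kumM θ (k + 1) x * kumM θ k x - k * ((1 / (θ + k) * kumM θ (k + 1) x +
    k / (θ + k) * kumN θ (k + 1) x) * kumM θ k x -
      kumN θ k x * (k / (θ + k) * kumM θ (k + 1) x)) = k ^ 2 / (θ + k) *
      (kumN θ k x * kumM θ (k + 1) x - kumN θ (k + 1) x * kumM θ k x) := by
    field_simp
    ring
  rw [e] at key
  have hp : 0 < (k : ℝ) ^ 2 / (θ + k) := by positivity
  exact sub_pos.1 ((pos_iff_pos_of_mul_pos key).1 hp)

lemma continuous_kumM (hθ : 0 < θ) (hk : 1 ≤ k) : Continuous (kumM θ k) :=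
  continuous_iff_continuousAt.2 fun x => (hasDerivAt_kumM hθ hk x).continuousAt

lemma continuous_kumN (hθ : 0 < θ) (hk : 1 ≤ k) : Continuous (kumN θ k) :=
  continuous_iff_continuousAt.2 fun x => (hasDerivAt_kumN hθ hk x).continuousAt

lemma strictMonoOn_kumN_div (hθ : 0 < θ) (hk : 1 ≤ k) :
    StrictMonoOn (fun x => kumN θ k x / kumM θ k x) (Set.Ici 0) := by
  refine strictMonoOn_of_deriv_pos (convex_Ici 0)
    ((continuous_kumN hθ hk).continuousOn.div (continuous_kumM hθ hk).continuousOn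
      fun x hx => (kumM_pos hθ hk hx).ne') fun x hx => ?_
  rw [interior_Ici, Set.mem_Ioi] at hx
  have h0 := kumM_pos hθ hk hx.le
  have hd := (hasDerivAt_egf (geomBdd_failCoeff_mul hθ hk) x).div
    (hasDerivAt_egf (geomBdd_failCoeff hθ hk) x) h0.ne'
  change 0 < deriv (kumN θ k / kumM θ k) x
  rw [kumN, kumM, hd.deriv]
  have := wronskian_pos hθ hk hx
  exact div_pos this (by rw [kumM] at h0; positivity)

lemma tendsto_shiftHarm (hk : 1 ≤ k) : Filter.Tendsto (shiftHarm k) Filter.atTop Filter.atTop := by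
  have h : ¬ Summable fun i : ℕ => (1 / (k + i : ℝ)) := by
    intro h
    refine Real.not_summable_natCast_inv ((summable_nat_add_iff k).1 (h.congr fun i => ?_))
    push_cast
    rw [one_div, add_comm]
  exact (not_summable_iff_tendsto_nat_atTop_of_nonneg fun i => by positivity).1 h

/-- All but finitely many coefficients of `θ D_a M - M` are positive, so it is eventually
positive. -/
lemma exists_kumM_lt (hθ : 0 < θ) (hk : 1 ≤ k) : ∃ x : ℝ, 0 < x ∧ kumM θ k x < θ * kumN θ k x := by
  obtain ⟨J, hJ⟩ := Filter.eventually_atTop.1 ((tendsto_shiftHarm hk).eventually_ge_atTop (2 / θ))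
  have hJ2 : ∀ j, J ≤ j → 2 ≤ θ * shiftHarm k j := fun j hj => by
    have := hJ j hj
    rw [div_le_iff₀ hθ] at this
    linarith
  -- The index is shifted by one so that the powers below it are dominated by `x ^ J`.
  have hm := failCoeff_pos hθ hk (J + 1)
  -- `x` is chosen so that the term of degree `J + 1` outweighs the `J + 1` terms before it, each of
  -- which is at least `-x ^ J`.
  set x : ℝ := 1 + (J + 1) * (J + 1).factorial / failCoeff θ k (J + 1) with hxd
  have hx1 : 1 ≤ x := by
    rw [hxd]
    have : 0 ≤ (J + 1) * (J + 1).factorial / failCoeff θ k (J + 1) := by positivity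
    linarith
  have hx0 : 0 < x := by linarith
  refine ⟨x, hx0, ?_⟩
  set a : ℕ → ℝ := fun j => θ * (failCoeff θ k j * shiftHarm k j) + (-1) * failCoeff θ k j with ha
  have ga : GeomBdd a := ((geomBdd_failCoeff_mul hθ hk).const_mul θ).add
    ((geomBdd_failCoeff hθ hk).const_mul (-1))
  have hE : egf a x = θ * kumN θ k x - kumM θ k x := by
    rw [ha, egf_add ((geomBdd_failCoeff_mul hθ hk).const_mul θ)
      ((geomBdd_failCoeff hθ hk).const_mul (-1)), egf_const_mul, egf_const_mul, kumN, kumM]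
    ring
  rw [← sub_pos, ← hE]
  have hlow : ∀ j, -1 ≤ a j := fun j => by
    have h1 := failCoeff_le_one hθ hk j
    have h2 := failCoeff_pos hθ hk j
    have h3 := shiftHarm_nonneg k j
    have : 0 ≤ θ * (failCoeff θ k j * shiftHarm k j) := by positivity
    simp only [ha]; linarith
  have hhigh : ∀ j, J ≤ j → failCoeff θ k j ≤ a j := fun j hj => by
    have h2 := failCoeff_pos hθ hk j
    have h3 := mul_le_mul_of_nonneg_left (hJ2 j hj) h2.le
    simp only [ha]; linarith
  have hpart : ∑ j ∈ Finset.range (J + 2), a j * (x ^ j / (j.factorial : ℝ)) ≤ egf a x := by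
    refine (ga.summable x).sum_le_tsum _ fun j hj => ?_
    have h1 := hhigh j (by simp at hj; omega)
    have h2 := failCoeff_pos hθ hk j
    have : 0 ≤ a j := by linarith
    positivity
  refine lt_of_lt_of_le ?_ hpart
  rw [Finset.sum_range_succ]
  have hl : -((J + 1) * x ^ J) ≤ ∑ j ∈ Finset.range (J + 1), a j * (x ^ j / (j.factorial : ℝ)) := by
    calc -((J + 1) * x ^ J) = ∑ j ∈ Finset.range (J + 1), -(x ^ J) := by simp
      _ ≤ _ := Finset.sum_le_sum fun j hj => by
        have hj' : j ≤ J := by simp at hj; omega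
        have h1 : x ^ j / (j.factorial : ℝ) ≤ x ^ J :=
          (div_le_self (by positivity) (by exact_mod_cast Nat.factorial_pos j)).trans
            (pow_le_pow_right₀ hx1 hj')
        have h0 : 0 ≤ x ^ j / (j.factorial : ℝ) := by positivity
        nlinarith [hlow j]
  have hu : (J + 1) * x ^ J < a (J + 1) * (x ^ (J + 1) / ((J + 1).factorial : ℝ)) := by
    have h1 := hhigh (J + 1) (by omega)
    have hf : (0 : ℝ) < (J + 1).factorial := by positivity
    calc (J + 1) * x ^ J < failCoeff θ k (J + 1) * (x / (J + 1).factorial) * x ^ J := by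
          refine mul_lt_mul_of_pos_right ?_ (by positivity)
          rw [← mul_div_assoc, lt_div_iff₀ hf, ← div_lt_iff₀' hm, hxd]
          linarith
      _ = failCoeff θ k (J + 1) * (x ^ (J + 1) / ((J + 1).factorial : ℝ)) := by ring
      _ ≤ _ := by gcongr
  linarith

/-- The intermediate value theorem applies, since `θ D_a M - M` equals `-1` at `0`. -/
lemma exists_kum_root (hθ : 0 < θ) (hk : 1 ≤ k) :
    ∃ x : ℝ, 0 < x ∧ θ * kumN θ k x = kumM θ k x := by
  obtain ⟨y, hy, h⟩ := exists_kumM_lt hθ hk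
  have hc : ContinuousOn (fun x => θ * kumN θ k x - kumM θ k x) (Set.Icc 0 y) := by
    have := continuous_kumN hθ hk
    have := continuous_kumM hθ hk
    fun_prop
  have h0 : θ * kumN θ k 0 - kumM θ k 0 < 0 := by
    simp [kumN, kumM, egf_zero, shiftHarm, failCoeff]
  obtain ⟨x, hx, hx0⟩ := intermediate_value_Ioo hy.le hc ⟨h0, sub_pos.2 h⟩
  exact ⟨x, hx.1, sub_eq_zero.1 hx0⟩

lemma kum_le_iff (hθ : 0 < θ) (hk : 1 ≤ k) {r : ℝ} (hr : 0 < r)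
    (h : θ * kumN θ k r = kumM θ k r) {x : ℝ} (hx : 0 ≤ x) :
    θ * kumN θ k x ≤ kumM θ k x ↔ x ≤ r := by
  rw [← (strictMonoOn_kumN_div hθ hk).le_iff_le (Set.mem_Ici.2 hx) (Set.mem_Ici.2 hr.le)]
  have hM := kumM_pos hθ hk hx
  have e : kumN θ k r / kumM θ k r = 1 / θ := by
    have := kumM_pos hθ hk hr.le
    rw [← h] at this ⊢
    have : kumN θ k r ≠ 0 := by rintro h; simp [h] at this
    field_simp
  rw [e, div_le_div_iff₀ hM hθ, one_mul, mul_comm]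

lemma kum_root_lt_succ (hθ : 0 < θ) (hk : 1 ≤ k) {r s : ℝ} (hr : 0 < r) (hs : 0 < s)
    (h : θ * kumN θ k r = kumM θ k r) (h' : θ * kumN θ (k + 1) s = kumM θ (k + 1) s) : r < s := by
  by_contra hle
  have hsr : ¬ (r < s) := hle
  have h1 : θ * kumN θ (k + 1) r < kumM θ (k + 1) r := by
    have h2 := mul_lt_mul_of_pos_left (kumN_succ_mul_lt hθ hk hr) hθ
    rw [← mul_assoc, ← mul_assoc, h, mul_comm (kumM θ k r)] at h2
    exact lt_of_mul_lt_mul_right h2 (kumM_pos hθ hk hr.le).le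
  have h3 := (kum_le_iff hθ (by omega) hs h' hr.le).1 h1.le
  have : r = s := le_antisymm h3 (not_lt.1 hsr)
  subst this
  exact h1.ne h'

end

/-! ### Kummer's function and its derivative in the first parameter -/

lemma ascPochhammer_eval_succ (j : ℕ) (a : ℝ) :
    (ascPochhammer ℝ (j + 1)).eval a = (ascPochhammer ℝ j).eval a * (a + j) := by
  simp [ascPochhammer_succ_right]

lemma ascPochhammer_derivative_eval_succ (j : ℕ) (a : ℝ) :
    (ascPochhammer ℝ (j + 1)).derivative.eval a =
      (ascPochhammer ℝ j).derivative.eval a * (a + j) + (ascPochhammer ℝ j).eval a := by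
  simp [ascPochhammer_succ_right, Polynomial.derivative_mul]

lemma abs_ascPochhammer_le {R a : ℝ} (hR : 1 ≤ R) (ha : |a| ≤ R) (j : ℕ) :
    |(ascPochhammer ℝ j).eval a| ≤ R ^ j * j.factorial := by
  induction j with
  | zero => simp
  | succ j ih =>
    have h1 : |a + j| ≤ R * (j + 1) := by
      refine (abs_add_le _ _).trans ?_
      rw [Nat.abs_cast]
      nlinarith [(Nat.cast_nonneg j : (0 : ℝ) ≤ j)]
    rw [ascPochhammer_eval_succ, abs_mul]
    calc _ ≤ R ^ j * j.factorial * (R * (j + 1)) := by gcongr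
      _ = _ := by push_cast [Nat.factorial_succ]; ring

lemma abs_ascPochhammer_derivative_le {R a : ℝ} (hR : 1 ≤ R) (ha : |a| ≤ R) (j : ℕ) :
    |(ascPochhammer ℝ j).derivative.eval a| ≤ j * (R ^ j * j.factorial) := by
  induction j with
  | zero => simp
  | succ j ih =>
    have h1 : |a + j| ≤ R * (j + 1) := by
      refine (abs_add_le _ _).trans ?_
      rw [Nat.abs_cast]
      nlinarith [(Nat.cast_nonneg j : (0 : ℝ) ≤ j)]
    have h2 : 1 ≤ R * (j + 1) := by nlinarith [(Nat.cast_nonneg j : (0 : ℝ) ≤ j)]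
    have h3 : 0 ≤ R ^ j * j.factorial := by positivity
    rw [ascPochhammer_derivative_eval_succ]
    calc _ ≤ |(ascPochhammer ℝ j).derivative.eval a| * |a + j| + |(ascPochhammer ℝ j).eval a| := by
          rw [← abs_mul]; exact abs_add_le _ _
      _ ≤ j * (R ^ j * j.factorial) * (R * (j + 1)) + R ^ j * j.factorial * (R * (j + 1)) := by
          gcongr
          exact (abs_ascPochhammer_le hR ha j).trans (le_mul_of_one_le_right h3 h2)
      _ = _ := by push_cast [Nat.factorial_succ]; ring

lemma factorial_le_ascPochhammer {c : ℝ} (hc : 1 ≤ c) (j : ℕ) :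
    (j.factorial : ℝ) ≤ (ascPochhammer ℝ j).eval c := by
  induction j with
  | zero => simp
  | succ j ih =>
    rw [ascPochhammer_eval_succ, Nat.factorial_succ]
    push_cast
    rw [mul_comm]
    exact mul_le_mul ih (by linarith) (by positivity) (le_trans (by positivity) ih)

section
variable {θ : ℝ} {k : ℕ}

lemma ascPochhammer_div (hθ : 0 < θ) (hk : 1 ≤ k) (j : ℕ) :
    (ascPochhammer ℝ j).eval (k : ℝ) / (ascPochhammer ℝ j).eval (θ + k) = failCoeff θ k j := by
  have : (1 : ℝ) ≤ k := by exact_mod_cast hk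
  induction j with
  | zero => simp [failCoeff]
  | succ j ih =>
    have h1 := (factorial_le_ascPochhammer (c := θ + k) (by linarith) j)
    have h2 : (0 : ℝ) < j.factorial := by positivity
    rw [ascPochhammer_eval_succ, ascPochhammer_eval_succ, mul_div_mul_comm, ih, failCoeff,
      failCoeff, Finset.prod_range_succ]

lemma ascPochhammer_derivative_eval (hk : 1 ≤ k) (j : ℕ) :
    (ascPochhammer ℝ j).derivative.eval (k : ℝ) =
      (ascPochhammer ℝ j).eval (k : ℝ) * shiftHarm k j := by
  have : (1 : ℝ) ≤ k := by exact_mod_cast hk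
  induction j with
  | zero => simp [shiftHarm]
  | succ j ih =>
    rw [ascPochhammer_derivative_eval_succ, ascPochhammer_eval_succ, ih, shiftHarm, shiftHarm,
      Finset.sum_range_succ]
    field_simp

lemma kummerM_eq (hθ : 0 < θ) (hk : 1 ≤ k) (x : ℝ) : kummerM k (θ + k) x = kumM θ k x := by
  simp only [kummerM, kumM, egf, ascPochhammer_div hθ hk]

/-- The series may be differentiated termwise in `a`: near `k` the derivative of `(a)_j` is at most
`j R ^ j j!` with `R = k + 1`, while `(θ + k)_j ≥ j!`. In particular the derivative in the
definition of a critical root is a genuine one. -/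
lemma hasDerivAt_kummerM (hθ : 0 < θ) (hk : 1 ≤ k) (x : ℝ) :
    HasDerivAt (fun a : ℝ => kummerM a (θ + k) x) (kumN θ k x) k := by
  have hk1 : (1 : ℝ) ≤ k := by exact_mod_cast hk
  set R : ℝ := k + 1
  have hR : 1 ≤ R := by simp [R]
  have hu : Summable fun j : ℕ => j * (R ^ j * j.factorial) / j.factorial
      * (|x| ^ j / (j.factorial : ℝ)) := by
    refine Summable.of_nonneg_of_le (fun j => by positivity) (fun j => ?_)
      (Real.summable_pow_div_factorial (2 * (R * |x|)))
    have h2 : (j : ℝ) ≤ 2 ^ j := by exact_mod_cast (Nat.lt_two_pow_self (n := j)).le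
    have h3 : (j.factorial : ℝ) ≠ 0 := by positivity
    calc _ = j * (R * |x|) ^ j / (j.factorial : ℝ) := by rw [mul_pow]; field_simp
      _ ≤ 2 ^ j * (R * |x|) ^ j / (j.factorial : ℝ) := by gcongr
      _ = _ := by rw [← mul_pow]
  have hball : ∀ a ∈ Metric.ball (k : ℝ) 1, |a| ≤ R := fun a ha => by
    rw [Metric.mem_ball, Real.dist_eq] at ha
    have := abs_add_le (a - k) k
    rw [sub_add_cancel, Nat.abs_cast] at this
    simp only [R]; linarith
  have key := hasDerivAt_tsum_of_isPreconnected (𝕜 := ℝ) (t := Metric.ball (k : ℝ) 1)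
    (y := (k : ℝ)) (y₀ := (k : ℝ))
    (g := fun (j : ℕ) a => (ascPochhammer ℝ j).eval a / (ascPochhammer ℝ j).eval (θ + k)
      * (x ^ j / (j.factorial : ℝ)))
    (g' := fun (j : ℕ) a => (ascPochhammer ℝ j).derivative.eval a /
      (ascPochhammer ℝ j).eval (θ + k) * (x ^ j / (j.factorial : ℝ))) hu Metric.isOpen_ball
    (convex_ball _ _).isPreconnected
    (fun j a _ => (((ascPochhammer ℝ j).hasDerivAt a).div_const _).mul_const _)
    (fun j a ha => ?_) (by simp) ?_ (by simp)
  · simp only [ascPochhammer_derivative_eval hk, mul_div_right_comm, ascPochhammer_div hθ hk]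
      at key
    exact key
  · have h1 := factorial_le_ascPochhammer (c := θ + k) (by linarith) j
    have h2 : (0 : ℝ) < j.factorial := by positivity
    rw [norm_mul, norm_div, norm_div, norm_pow, Real.norm_eq_abs, Real.norm_eq_abs,
      Real.norm_eq_abs, Real.norm_eq_abs, Nat.abs_cast, abs_of_pos (h2.trans_le h1)]
    gcongr
    exact abs_ascPochhammer_derivative_le hR (hball a ha) j
  · simp only [ascPochhammer_div hθ hk]
    exact (geomBdd_failCoeff hθ hk).summable x

lemma isCriticalRoot_iff (hθ : 0 < θ) (hk : 1 ≤ k) (x : ℝ) :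
    IsCriticalRoot θ k x ↔ 0 < x ∧ θ * kumN θ k x = kumM θ k x := by
  rw [IsCriticalRoot, (hasDerivAt_kummerM hθ hk x).deriv, kummerM_eq hθ hk, sub_eq_zero]

/-! ### The adapted rewards -/

/-- Thinning: given the first `k` arrivals, the number of further arrivals is Poisson distributed,
whatever `k` is. -/
lemma posterior_poissonPrior {lam : ℝ} (hlam : 0 < lam) (t : ℝ) (k j : ℕ) :
    posterior (poissonPrior lam) t k j = poissonPrior ((1 - t) * lam) j := by
  have h : ∀ i : ℕ, ((k + i).choose k : ℝ) * poissonPrior lam (k + i) * (1 - t) ^ i =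
      lam ^ k / (k.factorial : ℝ) * Real.exp (-lam) * (((1 - t) * lam) ^ i / i.factorial) := by
    intro i
    rw [Nat.choose_symm_add, Nat.add_choose,
      Nat.cast_div (Nat.factorial_mul_factorial_dvd_factorial_add k i) (by positivity),
      poissonPrior]
    push_cast
    field_simp
    rw [mul_pow]
    ring
  have hE : ∑' i : ℕ, ((1 - t) * lam) ^ i / (i.factorial : ℝ) = Real.exp ((1 - t) * lam) := by
    rw [Real.exp_eq_exp_ℝ, NormedSpace.exp_eq_tsum_div]
  rw [posterior]
  simp only [h]
  rw [tsum_mul_left, hE, poissonPrior, Real.exp_neg ((1 - t) * lam)]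
  field_simp

lemma one_sub_ksProfile (hθ : 0 < θ) {n : ℕ} (hn : 1 ≤ n) :
    1 - ksProfile θ n = (n - 1) / (θ + n - 1) := by
  have : (1 : ℝ) ≤ n := by exact_mod_cast hn
  have : θ + n - 1 ≠ 0 := by linarith
  rw [ksProfile]
  field_simp
  ring

lemma s0_ksProfile (hθ : 0 < θ) (hk : 1 ≤ k) (j : ℕ) :
    s0 (ksProfile θ) (k + 1) (k + j) = failCoeff θ k j := by
  induction j with
  | zero => simp [s0, failCoeff]
  | succ j ih =>
    rw [s0, ← add_assoc, Finset.prod_Icc_succ_top (by omega), ← s0, ih, failCoeff, failCoeff,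
      Finset.prod_range_succ, one_sub_ksProfile hθ (by omega)]
    push_cast
    congr 2 <;> ring

lemma s1_ksProfile (hθ : 0 < θ) (hk : 1 ≤ k) (j : ℕ) :
    s1 (ksProfile θ) (k + 1) (k + j) = θ * (failCoeff θ k j * shiftHarm k j) := by
  have h : ∑ i ∈ Finset.Icc (k + 1) (k + j), ksProfile θ i / (1 - ksProfile θ i) =
      θ * shiftHarm k j := by
    induction j with
    | zero => simp [shiftHarm]
    | succ j ih =>
      have hk1 : (1 : ℝ) ≤ k := by exact_mod_cast hk
      rw [← add_assoc, Finset.sum_Icc_succ_top (by omega), ih, shiftHarm, shiftHarm,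
        Finset.sum_range_succ, one_sub_ksProfile hθ (by omega), ksProfile]
      have h1 : θ + ((k + j + 1 : ℕ) : ℝ) - 1 = θ + k + j := by push_cast; ring
      have h2 : ((k + j + 1 : ℕ) : ℝ) - 1 = k + j := by push_cast; ring
      rw [h1, h2]
      field_simp
  rw [s1, s0_ksProfile hθ hk, h]
  ring

lemma S0_eq (hθ : 0 < θ) (hk : 1 ≤ k) {lam : ℝ} (hlam : 0 < lam) (t : ℝ) :
    S0 (poissonPrior lam) (ksProfile θ) t k =
      Real.exp (-((1 - t) * lam)) * kumM θ k ((1 - t) * lam) := by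
  rw [S0, kumM, egf, ← tsum_mul_left]
  refine tsum_congr fun j => ?_
  rw [posterior_poissonPrior hlam, s0_ksProfile hθ hk, poissonPrior]
  ring

lemma S1_eq (hθ : 0 < θ) (hk : 1 ≤ k) {lam : ℝ} (hlam : 0 < lam) (t : ℝ) :
    S1 (poissonPrior lam) (ksProfile θ) t k =
      Real.exp (-((1 - t) * lam)) * (θ * kumN θ k ((1 - t) * lam)) := by
  rw [S1, kumN, egf, ← tsum_mul_left, ← tsum_mul_left]
  refine tsum_congr fun j => ?_
  rw [posterior_poissonPrior hlam, s1_ksProfile hθ hk, poissonPrior]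
  ring

lemma mem_myopicSet_iff (hθ : 0 < θ) (hk : 1 ≤ k) {lam : ℝ} (hlam : 0 < lam) {r : ℝ}
    (hr : IsCriticalRoot θ k r) {t : ℝ} (ht : t ≤ 1) :
    (t, k) ∈ myopicSet (poissonPrior lam) (ksProfile θ) ↔ (1 - t) * lam ≤ r := by
  obtain ⟨hr0, h⟩ := (isCriticalRoot_iff hθ hk r).1 hr
  rw [← kum_le_iff hθ hk hr0 h (mul_nonneg (sub_nonneg.2 ht) hlam.le)]
  simp only [myopicSet, Set.mem_ofPred_eq, S0_eq hθ hk hlam, S1_eq hθ hk hlam]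
  exact mul_le_mul_iff_right₀ (Real.exp_pos _)

lemma existsUnique_isCriticalRoot (hθ : 0 < θ) (hk : 1 ≤ k) : ∃! x, IsCriticalRoot θ k x := by
  obtain ⟨r, hr0, hr⟩ := exists_kum_root hθ hk
  refine ⟨r, (isCriticalRoot_iff hθ hk r).2 ⟨hr0, hr⟩, fun s hs => ?_⟩
  obtain ⟨hs0, hs⟩ := (isCriticalRoot_iff hθ hk s).1 hs
  exact le_antisymm ((kum_le_iff hθ hk hr0 hr hs0.le).1 hs.le)
    ((kum_le_iff hθ hk hs0 hs hr0.le).1 hr.le)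

lemma isCriticalRoot_lt_succ (hθ : 0 < θ) (hk : 1 ≤ k) {r s : ℝ} (hr : IsCriticalRoot θ k r)
    (hs : IsCriticalRoot θ (k + 1) s) : r < s := by
  obtain ⟨hr0, hr⟩ := (isCriticalRoot_iff hθ hk r).1 hr
  obtain ⟨hs0, hs⟩ := (isCriticalRoot_iff hθ (by omega) s).1 hs
  exact kum_root_lt_succ hθ hk hr0 hs0 hr hs

end

/-! ### Independence structure of the marked Poisson process -/

section
variable {Ω : Type*} {lam : ℝ} {p : ℕ → ℝ} {T : ℕ → Ω → ℝ} {X : ℕ → Ω → Bool}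

/-- The σ-algebras generated by the single sources of randomness: the interarrival times (left) and
the marks (right). Index `n` belongs to the `(n + 1)`-st arrival in both cases. -/
abbrev sourceSigma (T : ℕ → Ω → ℝ) (X : ℕ → Ω → Bool) : ℕ ⊕ ℕ → MeasurableSpace Ω
  | .inl n => MeasurableSpace.comap (fun ω => T (n + 1) ω - T n ω) inferInstance
  | .inr n => MeasurableSpace.comap (X (n + 1)) inferInstance

/-- The σ-algebra generated by a set of sources of randomness. -/
abbrev sourcesSigma (T : ℕ → Ω → ℝ) (X : ℕ → Ω → Bool) (S : Set (ℕ ⊕ ℕ)) : MeasurableSpace Ω :=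
  ⨆ i ∈ S, sourceSigma T X i

/-- The sources behind the first `k` arrivals: their epochs and marks. -/
def pastSources (k : ℕ) : Set (ℕ ⊕ ℕ) := {i | Sum.elim id id i < k}

/-- The sources behind the epochs of the first `k` arrivals and all the marks. -/
def epochSources (k : ℕ) : Set (ℕ ⊕ ℕ) := {i | ∀ n, i = Sum.inl n → n < k}

/-- The sources behind the marks of the arrivals `k + 1, k + 2, …`. -/
def futureMarks (k : ℕ) : Set (ℕ ⊕ ℕ) := {i | ∃ n, k ≤ n ∧ i = Sum.inr n}

lemma sourcesSigma_mono {S S' : Set (ℕ ⊕ ℕ)} (h : S ⊆ S') :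
    sourcesSigma T X S ≤ sourcesSigma T X S' :=
  biSup_mono h

lemma sourceSigma_le_sourcesSigma {S : Set (ℕ ⊕ ℕ)} {i : ℕ ⊕ ℕ} (h : i ∈ S) :
    sourceSigma T X i ≤ sourcesSigma T X S :=
  le_biSup (sourceSigma T X) h

lemma measurable_mark {S : Set (ℕ ⊕ ℕ)} {n : ℕ} (h : Sum.inr n ∈ S) :
    Measurable[sourcesSigma T X S] (X (n + 1)) :=
  Measurable.mono (comap_measurable _) (sourceSigma_le_sourcesSigma h) le_rfl

lemma measurable_gap {S : Set (ℕ ⊕ ℕ)} {n : ℕ} (h : Sum.inl n ∈ S) :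
    Measurable[sourcesSigma T X S] fun ω => T (n + 1) ω - T n ω :=
  Measurable.mono (comap_measurable _) (sourceSigma_le_sourcesSigma h) le_rfl

lemma measurable_epoch (h0 : ∀ ω, T 0 ω = 0) {S : Set (ℕ ⊕ ℕ)} {k : ℕ}
    (h : ∀ n, n < k → Sum.inl n ∈ S) : Measurable[sourcesSigma T X S] (T k) := by
  induction k with
  | zero =>
    have : T 0 = fun _ => (0 : ℝ) := funext h0
    rw [this]
    exact measurable_const
  | succ k ih =>
    have : T (k + 1) = fun ω => (T (k + 1) ω - T k ω) + T k ω := by ext ω; ring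
    rw [this]
    exact (measurable_gap (h k (by omega))).add (ih fun n hn => h n (by omega))

lemma measurable_mark_past {n k : ℕ} (h1 : 1 ≤ n) (hn : n ≤ k) :
    Measurable[sourcesSigma T X (pastSources k)] (X n) := by
  obtain ⟨m, rfl⟩ := Nat.exists_eq_add_of_le' h1
  exact measurable_mark (by simp [pastSources]; omega)

variable [mΩ : MeasurableSpace Ω] {P : Measure Ω}

namespace IsMarkedPoisson

lemma sourceSigma_le (h : IsMarkedPoisson P lam p T X) (i : ℕ ⊕ ℕ) : sourceSigma T X i ≤ mΩ := by
  cases i with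
  | inl n => exact ((h.measurable_T _).sub (h.measurable_T _)).comap_le
  | inr n => exact (h.measurable_X _).comap_le

lemma sourcesSigma_le (h : IsMarkedPoisson P lam p T X) (S : Set (ℕ ⊕ ℕ)) :
    sourcesSigma T X S ≤ mΩ :=
  iSup₂_le fun i _ => h.sourceSigma_le i

/-- All interarrival times and marks form one independent family. -/
lemma iIndep_sourceSigma (h : IsMarkedPoisson P lam p T X) : iIndep (sourceSigma T X) P := by
  rw [iIndep_iff]
  intro S f hf
  have hl : ∀ n ∈ S.toLeft, MeasurableSet[sourceSigma T X (.inl n)] (f (.inl n)) := fun n hn =>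
    hf _ (Finset.mem_toLeft.1 hn)
  have hr : ∀ n ∈ S.toRight, MeasurableSet[sourceSigma T X (.inr n)] (f (.inr n)) := fun n hn =>
    hf _ (Finset.mem_toRight.1 hn)
  have e : ⋂ i ∈ S, f i = (⋂ n ∈ S.toLeft, f (.inl n)) ∩ ⋂ n ∈ S.toRight, f (.inr n) := by
    ext ω
    simp
  have hT : ∀ n, Measurable[MeasurableSpace.comap (fun ω (n : ℕ) => T (n + 1) ω) inferInstance]
      (T n) := by
    intro n
    cases n with
    | zero =>
      have : T 0 = fun _ => (0 : ℝ) := funext h.T_zero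
      rw [this]
      exact measurable_const
    | succ n =>
      exact (measurable_pi_apply (X := fun _ : ℕ => ℝ) n).comp
        (comap_measurable fun ω (n : ℕ) => T (n + 1) ω)
  have hX : ∀ n, Measurable[MeasurableSpace.comap (fun ω (n : ℕ) => X (n + 1) ω) inferInstance]
      (X (n + 1)) := fun n =>
    (measurable_pi_apply (X := fun _ : ℕ => Bool) n).comp
      (comap_measurable fun ω (n : ℕ) => X (n + 1) ω)
  have hi := (IndepFun_iff_Indep _ _ _).1 h.epochs_indep_marks
  have h1 : P (⋂ n ∈ S.toLeft, f (.inl n)) = ∏ n ∈ S.toLeft, P (f (.inl n)) :=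
    h.gap_indep.iIndep.meas_biInter hl
  have h2 : P (⋂ n ∈ S.toRight, f (.inr n)) = ∏ n ∈ S.toRight, P (f (.inr n)) :=
    h.mark_indep.iIndep.meas_biInter hr
  have hS : S = S.toLeft.disjSum S.toRight := Finset.toLeft_disjSum_toRight.symm
  rw [e, (Indep_iff _ _ _).1 hi _ _ (Finset.measurableSet_biInter _ fun n hn => ?_)
    (Finset.measurableSet_biInter _ fun n hn => ?_), h1, h2]
  · conv_rhs => rw [hS, Finset.prod_disjSum]
  · exact ((hT (n + 1)).sub (hT n)).comap_le _ (hl n hn)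
  · exact (hX n).comap_le _ (hr n hn)

lemma indep_sourcesSigma (h : IsMarkedPoisson P lam p T X) {S S' : Set (ℕ ⊕ ℕ)}
    (hS : Disjoint S S') : Indep (sourcesSigma T X S) (sourcesSigma T X S') P :=
  indep_iSup_of_disjoint h.sourceSigma_le h.iIndep_sourceSigma hS

lemma measurable_epoch_past (h : IsMarkedPoisson P lam p T X) {n k : ℕ} (hn : n ≤ k) :
    Measurable[sourcesSigma T X (pastSources k)] (T n) :=
  measurable_epoch h.T_zero fun m hm => by simp [pastSources]; omega

lemma measurable_epoch_epoch (h : IsMarkedPoisson P lam p T X) {n k : ℕ} (hn : n ≤ k) :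
    Measurable[sourcesSigma T X (epochSources k)] (T n) :=
  measurable_epoch h.T_zero fun m hm => by simp [epochSources]; omega

end IsMarkedPoisson

lemma pastSources_subset (k : ℕ) : pastSources k ⊆ epochSources k := by
  rintro i hi n rfl
  simpa [pastSources] using hi

lemma futureMarks_subset (k : ℕ) : futureMarks k ⊆ epochSources k := by
  rintro i ⟨n, -, rfl⟩ m hm
  simp at hm

lemma epochSources_mono (k : ℕ) : epochSources k ⊆ epochSources (k + 1) :=
  fun _ hi n hn => (hi n hn).trans (Nat.lt_succ_self k)

lemma disjoint_past_future (k : ℕ) : Disjoint (pastSources k) (futureMarks k) := by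
  rw [Set.disjoint_left]
  rintro i hi ⟨n, hn, rfl⟩
  simp [pastSources] at hi
  omega

/-! ### The exponential law -/

lemma expMeasure_Ici (hlam : 0 < lam) {x : ℝ} (hx : 0 ≤ x) :
    expMeasure lam (Set.Ici x) = ENNReal.ofReal (poissonPrior (x * lam) 0) := by
  have := isProbabilityMeasure_expMeasure hlam
  have h1 : expMeasure lam (Set.Iio x) = ENNReal.ofReal (1 - Real.exp (-(lam * x))) := by
    rw [expMeasure, gammaMeasure, withDensity_apply _ measurableSet_Iio,
      setLIntegral_congr Iio_ae_eq_Iic]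
    have := lintegral_exponentialPDF_eq_antiDeriv hlam x
    rw [if_pos hx] at this
    exact this
  rw [← Set.compl_Iio, prob_compl_eq_one_sub measurableSet_Iio, h1, ← ENNReal.ofReal_one,
    ← ENNReal.ofReal_sub _ (by simp; positivity), poissonPrior]
  congr 1
  simp [mul_comm]

/-- The first-step decomposition of the Poisson law: the first arrival of the remaining time `x` is
exponential, and the arrivals after it are Poisson for what then remains. -/
lemma lintegral_expMeasure_poissonPrior (hlam : 0 < lam) {x : ℝ} (hx : 0 ≤ x) (j : ℕ) :
    ∫⁻ w, (Set.Iio x).indicator (fun w => ENNReal.ofReal (poissonPrior ((x - w) * lam) j)) w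
      ∂(expMeasure lam) = ENNReal.ofReal (poissonPrior (x * lam) (j + 1)) := by
  have hc : Continuous fun w : ℝ => poissonPrior ((x - w) * lam) j := by
    unfold poissonPrior; fun_prop
  have hm : Measurable fun w : ℝ => ENNReal.ofReal (poissonPrior ((x - w) * lam) j) :=
    hc.measurable.ennreal_ofReal
  set C : ℝ := lam ^ (j + 1) / j.factorial * Real.exp (-(x * lam)) with hC
  have hC0 : 0 ≤ C := by positivity
  have hpdf : Measurable (exponentialPDF lam) := (measurable_exponentialPDFReal lam).ennreal_ofReal
  have e : expMeasure lam = volume.withDensity (exponentialPDF lam) := rfl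
  rw [e, lintegral_withDensity_eq_lintegral_mul _ hpdf (hm.indicator measurableSet_Iio)]
  have e1 : (exponentialPDF lam * (Set.Iio x).indicator
      fun w => ENNReal.ofReal (poissonPrior ((x - w) * lam) j)) =
      (Set.Ico 0 x).indicator fun w => ENNReal.ofReal (C * (x - w) ^ j) := by
    ext w
    by_cases hw : w ∈ Set.Ico 0 x
    · rw [Pi.mul_apply, Set.indicator_of_mem hw, Set.indicator_of_mem (Set.mem_Iio.2 hw.2),
        exponentialPDF_of_nonneg hw.1, ← ENNReal.ofReal_mul (by positivity)]
      congr 1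
      have : Real.exp (-(x * lam)) = Real.exp (-(lam * w)) * Real.exp (-((x - w) * lam)) := by
        rw [← Real.exp_add]; congr 1; ring
      rw [poissonPrior, hC, this, mul_pow]
      field_simp
      ring
    · rw [Pi.mul_apply, Set.indicator_of_notMem hw]
      by_cases h0 : w < 0
      · rw [exponentialPDF_of_neg h0, zero_mul]
      · rw [Set.indicator_of_notMem, mul_zero]
        exact fun h => hw ⟨not_lt.1 h0, h⟩
  have hint : IntegrableOn (fun w : ℝ => C * (x - w) ^ j) (Set.Ioc 0 x) :=
    (by fun_prop : Continuous fun w : ℝ => C * (x - w) ^ j).integrableOn_Ioc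
  rw [e1, lintegral_indicator measurableSet_Ico, setLIntegral_congr Ico_ae_eq_Ioc,
    ← ofReal_integral_eq_lintegral_ofReal hint, ← intervalIntegral.integral_of_le hx,
    intervalIntegral.integral_const_mul,
    intervalIntegral.integral_comp_sub_left (fun w : ℝ => w ^ j) x, integral_pow, hC, poissonPrior]
  · congr 1
    push_cast [Nat.factorial_succ]
    simp only [sub_self, sub_zero, ne_eq, Nat.add_eq_zero_iff, one_ne_zero, and_false,
      not_false_eq_true, zero_pow, mul_pow]
    field_simp
  · filter_upwards [ae_restrict_mem measurableSet_Ioc] with w hw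
    have := hw.2
    have : 0 ≤ x - w := by linarith
    exact mul_nonneg hC0 (pow_nonneg this _)

/-! ### Counting the arrivals before time `1` -/

/-- The event that the last arrival before time `1` is the `n`-th. -/
def lastArrival (T : ℕ → Ω → ℝ) (n : ℕ) : Set Ω := {ω | T n ω < 1 ∧ 1 ≤ T (n + 1) ω}

namespace IsMarkedPoisson

lemma measurableSet_lastArrival (h : IsMarkedPoisson P lam p T X) (n : ℕ) :
    MeasurableSet (lastArrival T n) :=
  (measurableSet_lt (h.measurable_T _) measurable_const).inter
    (measurableSet_le measurable_const (h.measurable_T _))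

variable [IsProbabilityMeasure P]

/-- The next interarrival time is exponential and independent of the earlier epochs and of all the
marks. -/
lemma setLIntegral_gap (h : IsMarkedPoisson P lam p T X) {k : ℕ} {K : Set Ω}
    (hK : MeasurableSet[sourcesSigma T X (epochSources k)] K) {φ : ℝ × ℝ → ENNReal}
    (hφ : Measurable φ) :
    ∫⁻ ω in K, φ (T k ω, T (k + 1) ω - T k ω) ∂P =
      ∫⁻ ω in K, ∫⁻ w, φ (T k ω, w) ∂(expMeasure lam) ∂P := by
  have hle := h.sourcesSigma_le (epochSources k)
  have hK' : MeasurableSet K := hle _ hK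
  have hg : Measurable fun ω => T (k + 1) ω - T k ω := (h.measurable_T _).sub (h.measurable_T _)
  set Y : Ω → ENNReal × ℝ := fun ω => (K.indicator 1 ω, T k ω) with hY
  have hYm0 : Measurable[sourcesSigma T X (epochSources k)] (K.indicator (1 : Ω → ENNReal)) :=
    Measurable.indicator (measurable_const (a := (1 : ENNReal))) hK
  have hYm : Measurable[sourcesSigma T X (epochSources k)] Y :=
    hYm0.prodMk (h.measurable_epoch_epoch le_rfl)
  have hYm' : Measurable Y := hYm.mono hle le_rfl
  have hind : IndepFun Y (fun ω => T (k + 1) ω - T k ω) P := by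
    have hd : Disjoint (epochSources k) {Sum.inl k} := by
      rw [Set.disjoint_singleton_right]
      exact fun hk => lt_irrefl k (hk k rfl)
    have := h.indep_sourcesSigma hd
    rw [IndepFun_iff_Indep]
    refine indep_of_indep_of_le_right (indep_of_indep_of_le_left this hYm.comap_le) ?_
    exact sourceSigma_le_sourcesSigma (T := T) (X := X) (Set.mem_singleton (Sum.inl k))
  have hmap := hind.map_prod_eq_prod_map_map hYm'.aemeasurable hg.aemeasurable
  rw [h.gap_law k] at hmap
  have : SFinite (expMeasure lam) := by rw [← h.gap_law k]; infer_instance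
  have hψ : Measurable fun q : (ENNReal × ℝ) × ℝ => q.1.1 * φ (q.1.2, q.2) := by fun_prop
  have e : ∀ f : Ω → ENNReal, K.indicator f = fun ω => K.indicator 1 ω * f ω := fun f => by
    ext ω
    by_cases hω : ω ∈ K <;> simp [hω]
  calc _ = ∫⁻ ω, (fun q : (ENNReal × ℝ) × ℝ => q.1.1 * φ (q.1.2, q.2))
        (Y ω, T (k + 1) ω - T k ω) ∂P := by
        rw [← lintegral_indicator hK', e]
    _ = ∫⁻ q, q.1.1 * φ (q.1.2, q.2) ∂((P.map Y).prod (expMeasure lam)) := by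
        rw [← hmap, lintegral_map hψ (hYm'.prodMk hg)]
    _ = ∫⁻ y, ∫⁻ w, y.1 * φ (y.2, w) ∂(expMeasure lam) ∂(P.map Y) := by
        rw [lintegral_prod _ hψ.aemeasurable]
    _ = ∫⁻ ω, ∫⁻ w, (Y ω).1 * φ ((Y ω).2, w) ∂(expMeasure lam) ∂P := by
        rw [lintegral_map hψ.lintegral_prod_right' hYm']
    _ = _ := by
        rw [← lintegral_indicator hK', e]
        refine lintegral_congr fun ω => ?_
        rw [lintegral_const_mul _ (by fun_prop)]

/-- Given the first `k` epochs and all the marks, the number of further arrivals before time `1` is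
Poisson distributed with mean proportional to the remaining time. -/
lemma measure_inter_lastArrival (h : IsMarkedPoisson P lam p T X) (hlam : 0 < lam) (j : ℕ) :
    ∀ (k : ℕ) (K : Set Ω), MeasurableSet[sourcesSigma T X (epochSources k)] K →
      (∀ ω ∈ K, T k ω < 1) → P (K ∩ lastArrival T (k + j)) =
        ∫⁻ ω in K, ENNReal.ofReal (poissonPrior ((1 - T k ω) * lam) j) ∂P := by
  induction j with
  | zero =>
    intro k K hK hK1
    have hK' := h.sourcesSigma_le _ _ hK
    have hm : MeasurableSet {ω | 1 ≤ T k ω + (T (k + 1) ω - T k ω)} := by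
      simpa using measurableSet_le measurable_const (h.measurable_T (k + 1))
    have e : K ∩ lastArrival T (k + 0) = {ω | 1 ≤ T k ω + (T (k + 1) ω - T k ω)} ∩ K := by
      ext ω
      simp only [lastArrival, Set.mem_inter_iff, Set.mem_ofPred_eq, add_zero,
        add_sub_cancel]
      exact ⟨fun ⟨a, _, b⟩ => ⟨b, a⟩, fun ⟨a, b⟩ => ⟨b, hK1 ω b, a⟩⟩
    have hs : MeasurableSet {q : ℝ × ℝ | 1 ≤ q.1 + q.2} :=
      measurableSet_le measurable_const (by fun_prop)
    have key := h.setLIntegral_gap hK (φ := {q : ℝ × ℝ | 1 ≤ q.1 + q.2}.indicator 1)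
      (measurable_one.indicator hs)
    rw [e, ← Measure.restrict_apply hm, ← lintegral_indicator_one hm]
    refine key.trans (setLIntegral_congr_fun hK' fun ω hω => ?_)
    have hT := hK1 ω hω
    have hI : ∀ w : ℝ, {q : ℝ × ℝ | 1 ≤ q.1 + q.2}.indicator (1 : ℝ × ℝ → ENNReal) (T k ω, w) =
        (Set.Ici (1 - T k ω)).indicator 1 w := fun w => by
      simp [Set.indicator_apply]
      congr 1
      rw [add_comm]
    simp only [hI]
    rw [lintegral_indicator_one measurableSet_Ici, expMeasure_Ici hlam (by linarith)]
  | succ j ih =>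
    intro k K hK hK1
    have hK' := h.sourcesSigma_le _ _ hK
    set K1 : Set Ω := {ω | T (k + 1) ω < 1} ∩ K with hKK
    have hm : MeasurableSet {ω | T (k + 1) ω < 1} :=
      measurableSet_lt (h.measurable_T _) measurable_const
    have hK1m : MeasurableSet[sourcesSigma T X (epochSources (k + 1))] K1 :=
      MeasurableSet.inter
        (h.measurable_epoch_epoch le_rfl measurableSet_Iio)
        (sourcesSigma_mono (epochSources_mono k) _ hK)
    have e : K ∩ lastArrival T (k + (j + 1)) = K1 ∩ lastArrival T (k + 1 + j) := by
      ext ω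
      simp only [lastArrival, Set.mem_inter_iff, Set.mem_ofPred_eq, hKK,
        show k + (j + 1) = k + 1 + j by ring]
      refine ⟨fun ⟨a, b⟩ => ⟨⟨lt_of_le_of_lt ?_ b.1, a⟩, b⟩, fun ⟨⟨_, a⟩, b⟩ => ⟨a, b⟩⟩
      exact (h.strictMono_T ω).monotone (by omega)
    rw [e, ih (k + 1) K1 hK1m (fun ω hω => hω.1), hKK, ← Measure.restrict_restrict hm,
      ← lintegral_indicator hm]
    have hs : MeasurableSet {q : ℝ × ℝ | q.2 < 1 - q.1} :=
      measurableSet_lt (by fun_prop) (by fun_prop)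
    have hc : Continuous fun q : ℝ × ℝ => poissonPrior ((1 - q.1 - q.2) * lam) j := by
      unfold poissonPrior; fun_prop
    have key := h.setLIntegral_gap hK (φ := {q : ℝ × ℝ | q.2 < 1 - q.1}.indicator
      fun q => ENNReal.ofReal (poissonPrior ((1 - q.1 - q.2) * lam) j))
      (hc.measurable.ennreal_ofReal.indicator hs)
    have e2 : ∀ ω, {ω | T (k + 1) ω < 1}.indicator
        (fun ω => ENNReal.ofReal (poissonPrior ((1 - T (k + 1) ω) * lam) j)) ω =
        {q : ℝ × ℝ | q.2 < 1 - q.1}.indicator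
          (fun q => ENNReal.ofReal (poissonPrior ((1 - q.1 - q.2) * lam) j))
          (T k ω, T (k + 1) ω - T k ω) := fun ω => by
      simp only [Set.indicator_apply, Set.mem_ofPred_eq]
      have e3 : 1 - T k ω - (T (k + 1) ω - T k ω) = 1 - T (k + 1) ω := by ring
      have e4 : (T (k + 1) ω - T k ω < 1 - T k ω) ↔ T (k + 1) ω < 1 := by
        constructor <;> intro h <;> linarith
      rw [e3]
      simp only [e4]
    simp only [e2]
    refine key.trans (setLIntegral_congr_fun hK' fun ω hω => ?_)
    have hT := hK1 ω hω
    exact lintegral_expMeasure_poissonPrior hlam (by linarith : 0 ≤ 1 - T k ω) j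

end IsMarkedPoisson

end

/-! ### The rewards as conditional probabilities -/

section
variable {Ω : Type*} {lam θ : ℝ} {p : ℕ → ℝ} {T : ℕ → Ω → ℝ} {X : ℕ → Ω → Bool}

/-- The event that the marks of the arrivals `n + 1`, `n ∈ S`, are given by `b`. -/
def markPattern (X : ℕ → Ω → Bool) (S : Finset ℕ) (b : ℕ → Bool) : Set Ω :=
  ⋂ n ∈ S, X (n + 1) ⁻¹' {b n}

/-- The event that no success occurs after the `k`-th arrival and before time `1`. -/
def noneAfter (T : ℕ → Ω → ℝ) (X : ℕ → Ω → Bool) (k : ℕ) : Set Ω :=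
  {ω | ∀ n, k < n → T n ω < 1 → X n ω = false}

/-- The event that exactly one success occurs after the `k`-th arrival and before time `1`. -/
def oneAfter (T : ℕ → Ω → ℝ) (X : ℕ → Ω → Bool) (k : ℕ) : Set Ω :=
  {ω | ∃ i, k < i ∧ T i ω < 1 ∧ X i ω = true ∧
    ∀ n, k < n → T n ω < 1 → n ≠ i → X n ω = false}

lemma measurableSet_markPattern {S : Set (ℕ ⊕ ℕ)} {I : Finset ℕ} (h : ∀ n ∈ I, Sum.inr n ∈ S)
    (b : ℕ → Bool) : MeasurableSet[sourcesSigma T X S] (markPattern X I b) :=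
  Finset.measurableSet_biInter _ fun n hn => measurable_mark (h n hn) (measurableSet_singleton _)

lemma inr_mem_futureMarks {k j : ℕ} : ∀ n ∈ Finset.Ico k (k + j), Sum.inr n ∈ futureMarks k :=
  fun n hn => ⟨n, (Finset.mem_Ico.1 hn).1, rfl⟩

lemma disjoint_markPattern {I : Finset ℕ} {b b' : ℕ → Bool} {n : ℕ} (hn : n ∈ I) (h : b n ≠ b' n) :
    Disjoint (markPattern X I b) (markPattern X I b') := by
  rw [Set.disjoint_left]
  intro ω h1 h2
  simp only [markPattern, Set.mem_iInter, Set.mem_preimage, Set.mem_singleton_iff] at h1 h2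
  exact h ((h1 n hn).symm.trans (h2 n hn))

lemma s0_eq_prod (p : ℕ → ℝ) (k j : ℕ) :
    s0 p (k + 1) (k + j) = ∏ n ∈ Finset.Ico k (k + j), (1 - p (n + 1)) := by
  rw [s0, Finset.prod_Ico_add' (fun n => 1 - p n) k (k + j) 1]
  refine Finset.prod_congr ?_ fun _ _ => rfl
  ext n; simp

lemma s1_eq_sum {p : ℕ → ℝ} {k : ℕ} (hp : ∀ n, k ≤ n → p (n + 1) ≠ 1) (j : ℕ) :
    s1 p (k + 1) (k + j) = ∑ i ∈ Finset.Ico k (k + j),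
      ∏ n ∈ Finset.Ico k (k + j), if n = i then p (n + 1) else 1 - p (n + 1) := by
  have e : ∑ i ∈ Finset.Icc (k + 1) (k + j), p i / (1 - p i) =
      ∑ i ∈ Finset.Ico k (k + j), p (i + 1) / (1 - p (i + 1)) := by
    rw [Finset.sum_Ico_add' (fun n => p n / (1 - p n)) k (k + j) 1]
    refine Finset.sum_congr ?_ fun _ _ => rfl
    ext n; simp
  rw [s1, s0_eq_prod, e, Finset.mul_sum]
  refine Finset.sum_congr rfl fun i hi => ?_
  have h1 : 1 - p (i + 1) ≠ 0 := sub_ne_zero.2 (hp i (Finset.mem_Ico.1 hi).1).symm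
  rw [← Finset.mul_prod_erase _ _ hi, ← Finset.mul_prod_erase _ _ hi, if_pos rfl,
    Finset.prod_congr rfl (g := fun n => 1 - p (n + 1))
      fun n hn => if_neg (Finset.ne_of_mem_erase hn)]
  field_simp

lemma tsum_ofReal_poissonPrior {x : ℝ} (hx : 0 ≤ x) :
    ∑' j, ENNReal.ofReal (poissonPrior x j) = 1 := by
  rw [← ENNReal.ofReal_tsum_of_nonneg]
  · have hE : ∑' j : ℕ, x ^ j / (j.factorial : ℝ) = Real.exp x := by
      rw [Real.exp_eq_exp_ℝ, NormedSpace.exp_eq_tsum_div]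
    simp only [poissonPrior]
    rw [tsum_mul_right, hE, ← Real.exp_add]
    simp
  · intro j; unfold poissonPrior; positivity
  · exact (Real.summable_pow_div_factorial x).mul_right _

variable [mΩ : MeasurableSpace Ω] {P : Measure Ω}

namespace IsMarkedPoisson

lemma measurableSet_noneAfter (h : IsMarkedPoisson P lam p T X) (k : ℕ) :
    MeasurableSet (noneAfter T X k) := by
  have : noneAfter T X k = ⋂ n, ⋂ _ : k < n, ({ω | T n ω < 1}ᶜ ∪ X n ⁻¹' {false}) := by
    ext ω
    simp only [noneAfter, Set.mem_ofPred_eq, Set.mem_iInter, Set.mem_union, Set.mem_compl_iff,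
      Set.mem_preimage, Set.mem_singleton_iff, imp_iff_not_or]
  rw [this]
  exact MeasurableSet.iInter fun n => MeasurableSet.iInter fun _ =>
    (measurableSet_lt (h.measurable_T n) measurable_const).compl.union
      (h.measurable_X n (measurableSet_singleton _))

lemma measurableSet_oneAfter (h : IsMarkedPoisson P lam p T X) (k : ℕ) :
    MeasurableSet (oneAfter T X k) := by
  have : oneAfter T X k = ⋃ i, ⋃ _ : k < i, ({ω | T i ω < 1} ∩ X i ⁻¹' {true} ∩
      ⋂ n, ⋂ _ : k < n, ({ω | T n ω < 1}ᶜ ∪ ⋂ _ : n ≠ i, X n ⁻¹' {false})) := by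
    ext ω
    simp only [oneAfter, Set.mem_ofPred_eq, Set.mem_iUnion, Set.mem_iInter, Set.mem_union,
      Set.mem_compl_iff, Set.mem_preimage, Set.mem_singleton_iff, imp_iff_not_or, Set.mem_inter_iff,
      exists_prop, and_assoc]
  rw [this]
  exact MeasurableSet.iUnion fun i => MeasurableSet.iUnion fun _ =>
    ((measurableSet_lt (h.measurable_T i) measurable_const).inter
      (h.measurable_X i (measurableSet_singleton _))).inter
    (MeasurableSet.iInter fun n => MeasurableSet.iInter fun _ =>
      (measurableSet_lt (h.measurable_T n) measurable_const).compl.union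
        (MeasurableSet.iInter fun _ => h.measurable_X n (measurableSet_singleton _)))

lemma lt_one_iff (h : IsMarkedPoisson P lam p T X) {m n : ℕ} {ω : Ω} (hω : ω ∈ lastArrival T m) :
    T n ω < 1 ↔ n ≤ m := by
  refine ⟨fun hn => ?_, fun hn => ((h.strictMono_T ω).monotone hn).trans_lt hω.1⟩
  by_contra hlt
  exact absurd (hω.2.trans ((h.strictMono_T ω).monotone (not_le.1 hlt : m + 1 ≤ n))) (not_le.2 hn)

lemma noneAfter_inter_lastArrival (h : IsMarkedPoisson P lam p T X) (k j : ℕ) :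
    noneAfter T X k ∩ lastArrival T (k + j) =
      markPattern X (Finset.Ico k (k + j)) (fun _ => false) ∩ lastArrival T (k + j) := by
  ext ω
  refine and_congr_left fun hω => ?_
  simp only [noneAfter, markPattern, Set.mem_ofPred_eq, Set.mem_iInter, Set.mem_preimage,
    Set.mem_singleton_iff, h.lt_one_iff hω, Finset.mem_Ico]
  refine ⟨fun H n hn => H _ (by omega) (by omega), fun H n h1 h2 => ?_⟩
  obtain ⟨m, rfl⟩ := Nat.exists_eq_add_of_le' (show 1 ≤ n by omega)
  exact H m (by omega)

lemma oneAfter_inter_lastArrival (h : IsMarkedPoisson P lam p T X) (k j : ℕ) :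
    oneAfter T X k ∩ lastArrival T (k + j) =
      (⋃ i ∈ Finset.Ico k (k + j), markPattern X (Finset.Ico k (k + j)) (fun n => decide (n = i)))
        ∩ lastArrival T (k + j) := by
  ext ω
  refine and_congr_left fun hω => ?_
  simp only [oneAfter, markPattern, Set.mem_ofPred_eq, Set.mem_iInter, Set.mem_preimage,
    Set.mem_singleton_iff, h.lt_one_iff hω, Finset.mem_Ico, Set.mem_iUnion, exists_prop]
  constructor
  · rintro ⟨i, h1, h2, h3, H⟩
    obtain ⟨m, rfl⟩ := Nat.exists_eq_add_of_le' (show 1 ≤ i by omega)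
    refine ⟨m, by omega, fun n hn => ?_⟩
    by_cases hnm : n = m
    · simp [hnm, h3]
    · simpa [hnm] using H (n + 1) (by omega) (by omega) (by omega)
  · rintro ⟨i, hi, H⟩
    refine ⟨i + 1, by omega, by omega, by simpa using H i hi, fun n h1 h2 hne => ?_⟩
    obtain ⟨m, rfl⟩ := Nat.exists_eq_add_of_le' (show 1 ≤ n by omega)
    simpa [show m ≠ i by omega] using H m (by omega)

variable [IsProbabilityMeasure P]

lemma measure_mark (h : IsMarkedPoisson P lam p T X) (n : ℕ) (b : Bool) :
    P (X (n + 1) ⁻¹' {b}) = ENNReal.ofReal (if b then p (n + 1) else 1 - p (n + 1)) := by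
  have h1 : P.real (X (n + 1) ⁻¹' {true}) = p (n + 1) := h.mark_law (n + 1) (by omega)
  cases b with
  | true => rw [← ofReal_measureReal, h1]; simp
  | false =>
    have e : X (n + 1) ⁻¹' {false} = (X (n + 1) ⁻¹' {true})ᶜ := by ext ω; simp
    rw [← ofReal_measureReal, e, probReal_compl_eq_one_sub
      (h.measurable_X _ (measurableSet_singleton _)), h1]
    simp

lemma mark_prob_mem (h : IsMarkedPoisson P lam p T X) (n : ℕ) :
    0 ≤ p (n + 1) ∧ p (n + 1) ≤ 1 := by
  rw [← h.mark_law (n + 1) (by omega)]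
  exact ⟨measureReal_nonneg, measureReal_le_one⟩

lemma measure_markPattern (h : IsMarkedPoisson P lam p T X) (I : Finset ℕ) (b : ℕ → Bool) :
    P (markPattern X I b) =
      ENNReal.ofReal (∏ n ∈ I, if b n then p (n + 1) else 1 - p (n + 1)) := by
  rw [markPattern, h.mark_indep.measure_inter_preimage_eq_mul I
    (sets := fun n => {b n}) (fun n _ => measurableSet_singleton _),
    ENNReal.ofReal_prod_of_nonneg]
  · exact Finset.prod_congr rfl fun n _ => h.measure_mark n (b n)
  · intro n _
    have := h.mark_prob_mem n
    split_ifs <;> linarith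

lemma measure_markPattern_none (h : IsMarkedPoisson P lam p T X) (k j : ℕ) :
    P (markPattern X (Finset.Ico k (k + j)) fun _ => false) =
      ENNReal.ofReal (s0 p (k + 1) (k + j)) := by
  rw [h.measure_markPattern, s0_eq_prod]
  simp

lemma measure_markPattern_one (h : IsMarkedPoisson P lam p T X) {k : ℕ}
    (hp : ∀ n, k ≤ n → p (n + 1) ≠ 1) (j : ℕ) :
    P (⋃ i ∈ Finset.Ico k (k + j),
      markPattern X (Finset.Ico k (k + j)) fun n => decide (n = i)) =
      ENNReal.ofReal (s1 p (k + 1) (k + j)) := by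
  rw [measure_biUnion_finset, s1_eq_sum hp, ENNReal.ofReal_sum_of_nonneg]
  · refine Finset.sum_congr rfl fun i _ => ?_
    rw [h.measure_markPattern]
    simp
  · intro i _
    refine Finset.prod_nonneg fun n _ => ?_
    have := h.mark_prob_mem n
    split_ifs <;> linarith
  · intro i hi i' _ hne
    exact disjoint_markPattern (Finset.mem_coe.1 hi) (by simpa using hne)
  · intro i _
    exact h.sourcesSigma_le Set.univ _ (measurableSet_markPattern (fun _ _ => Set.mem_univ _) _)

/-- Only finitely many arrivals occur before time `1`: almost surely one of them is the last. -/
lemma measure_diff_lastArrival (h : IsMarkedPoisson P lam p T X) (hlam : 0 < lam) {k : ℕ}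
    {K : Set Ω} (hK : MeasurableSet[sourcesSigma T X (pastSources k)] K)
    (hK1 : ∀ ω ∈ K, T k ω < 1) : P (K \ ⋃ j, lastArrival T (k + j)) = 0 := by
  have hK' := h.sourcesSigma_le _ _ hK
  have hU : MeasurableSet (⋃ j, lastArrival T (k + j)) :=
    MeasurableSet.iUnion fun j => h.measurableSet_lastArrival _
  have hpois : ∀ j, Measurable fun ω => ENNReal.ofReal (poissonPrior ((1 - T k ω) * lam) j) :=
    fun j => by
      have := h.measurable_T k
      unfold poissonPrior
      fun_prop
  have h1 : P (K ∩ ⋃ j, lastArrival T (k + j)) = P K := by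
    rw [Set.inter_iUnion, measure_iUnion]
    · rw [tsum_congr fun j => h.measure_inter_lastArrival hlam j k K
        (sourcesSigma_mono (pastSources_subset k) _ hK) hK1,
        ← lintegral_tsum fun j => (hpois j).aemeasurable,
        setLIntegral_congr_fun hK' (g := fun _ => 1), setLIntegral_one]
      intro ω hω
      have := hK1 ω hω
      exact tsum_ofReal_poissonPrior (mul_nonneg (by linarith) hlam.le)
    · intro i j hij
      refine Set.disjoint_left.2 fun ω hi hj => hij ?_
      have e1 := (h.lt_one_iff hi.2).1 hj.2.1
      have e2 := (h.lt_one_iff hj.2).1 hi.2.1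
      omega
    · exact fun j => hK'.inter (h.measurableSet_lastArrival _)
  have h2 := measure_inter_add_sdiff (μ := P) K hU
  rw [h1] at h2
  exact (ENNReal.add_right_inj (measure_ne_top P K)).1 (h2.trans (add_zero _).symm)

/-- An event `A` that is determined by the marks after the `k`-th arrival once the number of
arrivals is known has a conditional probability, given the past of the `k`-th arrival, that is a
Poisson mixture of probabilities of mark events. -/
lemma measure_inter_of_futureMarks (h : IsMarkedPoisson P lam p T X) (hlam : 0 < lam) {k : ℕ}
    {K A : Set Ω} (hK : MeasurableSet[sourcesSigma T X (pastSources k)] K)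
    (hK1 : ∀ ω ∈ K, T k ω < 1) (hA : MeasurableSet A) {M : ℕ → Set Ω}
    (hM : ∀ j, MeasurableSet[sourcesSigma T X (futureMarks k)] (M j))
    (hAM : ∀ j, A ∩ lastArrival T (k + j) = M j ∩ lastArrival T (k + j)) :
    P (K ∩ A) =
      ∫⁻ ω in K, ∑' j, P (M j) * ENNReal.ofReal (poissonPrior ((1 - T k ω) * lam) j) ∂P := by
  have hK' := h.sourcesSigma_le _ _ hK
  have hM' := fun j => h.sourcesSigma_le _ _ (hM j)
  have hU : MeasurableSet (⋃ j, lastArrival T (k + j)) :=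
    MeasurableSet.iUnion fun j => h.measurableSet_lastArrival _
  have hpois : ∀ j, Measurable[sourcesSigma T X (pastSources k)]
      fun ω => ENNReal.ofReal (poissonPrior ((1 - T k ω) * lam) j) :=
    fun j => by
      have hc : Measurable fun t : ℝ => ENNReal.ofReal (poissonPrior ((1 - t) * lam) j) := by
        unfold poissonPrior; fun_prop
      exact hc.comp (h.measurable_epoch_past le_rfl)
  have hpois' := fun j => (hpois j).mono (h.sourcesSigma_le _) le_rfl
  have h1 : P ((K ∩ A) \ ⋃ j, lastArrival T (k + j)) = 0 :=
    measure_mono_null (Set.sdiff_subset_sdiff_left Set.inter_subset_left)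
      (h.measure_diff_lastArrival hlam hK hK1)
  rw [← measure_inter_add_sdiff (μ := P) (K ∩ A) hU, h1, add_zero, Set.inter_iUnion, measure_iUnion,
    lintegral_tsum fun j => ((hpois' j).const_mul _).aemeasurable]
  · refine tsum_congr fun j => ?_
    have hKM : MeasurableSet[sourcesSigma T X (epochSources k)] (K ∩ M j) :=
      (sourcesSigma_mono (pastSources_subset k) _ hK).inter
        (sourcesSigma_mono (futureMarks_subset k) _ (hM j))
    have hMi : Measurable[sourcesSigma T X (futureMarks k)] ((M j).indicator (1 : Ω → ENNReal)) :=
      Measurable.indicator (measurable_const (a := (1 : ENNReal))) (hM j)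
    rw [Set.inter_assoc, hAM, ← Set.inter_assoc,
      h.measure_inter_lastArrival hlam j k _ hKM fun ω hω => hK1 ω hω.1,
      lintegral_const_mul _ (hpois' j), ← lintegral_indicator (hK'.inter (hM' j)),
      ← lintegral_indicator hK', ← lintegral_indicator_one (hM' j), mul_comm,
      ← lintegral_mul_eq_lintegral_mul_lintegral_of_independent_measurableSpace
        (h.sourcesSigma_le (pastSources k)) (h.sourcesSigma_le (futureMarks k))
        (h.indep_sourcesSigma (disjoint_past_future k)) ((hpois j).indicator hK)
        hMi]
    refine lintegral_congr fun ω => ?_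
    by_cases h1 : ω ∈ K <;> by_cases h2 : ω ∈ M j <;> simp [h1, h2]
  · intro i j hij
    refine Set.disjoint_left.2 fun ω hi hj => hij ?_
    have e1 := (h.lt_one_iff hi.2).1 hj.2.1
    have e2 := (h.lt_one_iff hj.2).1 hi.2.1
    omega
  · exact fun j => (hK'.inter hA).inter (h.measurableSet_lastArrival _)

/-- The reward `S₀` is the conditional probability that no success follows. -/
lemma measure_inter_noneAfter (h : IsMarkedPoisson P lam (ksProfile θ) T X) (hθ : 0 < θ)
    (hlam : 0 < lam) {k : ℕ} (hk : 1 ≤ k) {K : Set Ω}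
    (hK : MeasurableSet[sourcesSigma T X (pastSources k)] K) (hK1 : ∀ ω ∈ K, T k ω < 1) :
    P (K ∩ noneAfter T X k) =
      ∫⁻ ω in K, ENNReal.ofReal (S0 (poissonPrior lam) (ksProfile θ) (T k ω) k) ∂P := by
  rw [h.measure_inter_of_futureMarks hlam hK hK1 (h.measurableSet_noneAfter k)
    (fun j => measurableSet_markPattern inr_mem_futureMarks _)
    (h.noneAfter_inter_lastArrival k)]
  refine setLIntegral_congr_fun (h.sourcesSigma_le _ _ hK) fun ω hω => ?_
  have hx : 0 ≤ (1 - T k ω) * lam := mul_nonneg (by have := hK1 ω hω; linarith) hlam.le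
  simp only [h.measure_markPattern_none, S0, posterior_poissonPrior hlam, s0_ksProfile hθ hk]
  rw [ENNReal.ofReal_tsum_of_nonneg]
  · refine tsum_congr fun j => ?_
    have h0 : 0 ≤ poissonPrior ((1 - T k ω) * lam) j := by unfold poissonPrior; positivity
    rw [mul_comm, ENNReal.ofReal_mul h0]
  · intro j
    have := failCoeff_pos hθ hk j
    unfold poissonPrior; positivity
  · refine (((geomBdd_failCoeff hθ hk).summable ((1 - T k ω) * lam)).mul_right
      (Real.exp (-((1 - T k ω) * lam)))).congr fun j => ?_
    rw [poissonPrior]; ring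

/-- The reward `S₁` is the conditional probability that exactly one success follows. -/
lemma measure_inter_oneAfter (h : IsMarkedPoisson P lam (ksProfile θ) T X) (hθ : 0 < θ)
    (hlam : 0 < lam) {k : ℕ} (hk : 1 ≤ k) {K : Set Ω}
    (hK : MeasurableSet[sourcesSigma T X (pastSources k)] K) (hK1 : ∀ ω ∈ K, T k ω < 1) :
    P (K ∩ oneAfter T X k) =
      ∫⁻ ω in K, ENNReal.ofReal (S1 (poissonPrior lam) (ksProfile θ) (T k ω) k) ∂P := by
  -- The first trial is a sure success, so the odds of a success are meaningful from the second on.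
  have hp : ∀ n, k ≤ n → ksProfile θ (n + 1) ≠ 1 := fun n hn => by
    have : (0 : ℝ) < n := by exact_mod_cast hk.trans hn
    have h1 := one_sub_ksProfile hθ (n := n + 1) (by omega)
    have h2 : 0 < 1 - ksProfile θ (n + 1) := by
      rw [h1]; push_cast; rw [add_sub_cancel_right]
      exact div_pos this (by linarith)
    linarith
  rw [h.measure_inter_of_futureMarks hlam hK hK1 (h.measurableSet_oneAfter k)
    (fun j => Finset.measurableSet_biUnion _ fun i _ =>
      measurableSet_markPattern inr_mem_futureMarks _)
    (h.oneAfter_inter_lastArrival k)]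
  refine setLIntegral_congr_fun (h.sourcesSigma_le _ _ hK) fun ω hω => ?_
  have hx : 0 ≤ (1 - T k ω) * lam := mul_nonneg (by have := hK1 ω hω; linarith) hlam.le
  simp only [h.measure_markPattern_one hp, S1, posterior_poissonPrior hlam, s1_ksProfile hθ hk]
  rw [ENNReal.ofReal_tsum_of_nonneg]
  · refine tsum_congr fun j => ?_
    have h0 : 0 ≤ poissonPrior ((1 - T k ω) * lam) j := by unfold poissonPrior; positivity
    rw [mul_comm, ENNReal.ofReal_mul h0]
  · intro j
    have := failCoeff_pos hθ hk j
    have := shiftHarm_nonneg k j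
    unfold poissonPrior; positivity
  · refine ((((geomBdd_failCoeff_mul hθ hk).const_mul θ).summable ((1 - T k ω) * lam)).mul_right
      (Real.exp (-((1 - T k ω) * lam)))).congr fun j => ?_
    rw [poissonPrior]; ring

end IsMarkedPoisson

end

/-! ### Stopping at an arrival is decided by the past of that arrival -/

section
variable {Ω : Type*} {lam θ : ℝ} {p : ℕ → ℝ} {T : ℕ → Ω → ℝ} {X : ℕ → Ω → Bool}
  [mΩ : MeasurableSpace Ω] {P : Measure Ω}

namespace IsMarkedPoisson

/-- While the `k`-th arrival is the most recent one, the information at time `t` consists of the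
past of the `k`-th arrival. -/
lemma exists_past_of_arrivalFiltration (h : IsMarkedPoisson P lam p T X) (k : ℕ) {t : ℝ}
    {A : Set Ω} (hA : MeasurableSet[arrivalFiltration T X h.measurable_T h.measurable_X t] A) :
    ∃ B, MeasurableSet[sourcesSigma T X (pastSources k)] B ∧
      ∀ ω, T k ω ≤ t → t < T (k + 1) ω → (ω ∈ A ↔ ω ∈ B) := by
  induction A, hA using MeasurableSpace.generateFrom_induction with
  | hC A hA' hA =>
    obtain ⟨n, hn, s, hs, hA⟩ := hA'
    by_cases hnk : n ≤ k
    · have hT : MeasurableSet[sourcesSigma T X (pastSources k)] {ω | T n ω ≤ s} :=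
        h.measurable_epoch_past hnk measurableSet_Iic
      have hX : MeasurableSet[sourcesSigma T X (pastSources k)] {ω | X n ω = true} :=
        measurable_mark_past hn hnk (measurableSet_singleton true)
      refine ⟨A, ?_, fun _ _ _ => Iff.rfl⟩
      rcases hA with rfl | rfl
      · exact hT
      · exact hT.inter hX
    · refine ⟨∅, @MeasurableSet.empty _ (sourcesSigma T X (pastSources k)), fun ω _ h2 => ?_⟩
      have h3 : ¬ T n ω ≤ s := by
        have : T (k + 1) ω ≤ T n ω := (h.strictMono_T ω).monotone (by omega)
        intro h4
        linarith
      rcases hA with rfl | rfl <;> simp [h3]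
  | empty =>
    exact ⟨∅, @MeasurableSet.empty _ (sourcesSigma T X (pastSources k)), fun _ _ _ => Iff.rfl⟩
  | compl A hA ih =>
    obtain ⟨B, hB, hAB⟩ := ih
    exact ⟨Bᶜ, hB.compl, fun ω h1 h2 => not_congr (hAB ω h1 h2)⟩
  | iUnion A hA ih =>
    choose B hB hAB using ih
    refine ⟨⋃ n, B n, MeasurableSet.iUnion hB, fun ω h1 h2 => ?_⟩
    simp only [Set.mem_iUnion, hAB _ ω h1 h2]

/-- A strategy decides whether to stop by the `k`-th arrival on the basis of its past. The decision
is read off at the times `(⌊(m + 1) T k⌋ + 1) / (m + 1)`, which decrease to `T k` from the right and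
are eventually smaller than `T (k + 1)`. -/
lemma measurableSet_le_epoch (h : IsMarkedPoisson P lam p T X) {σ : Ω → ℝ}
    (hσ : IsStrategy T X h.measurable_T h.measurable_X σ) (k : ℕ) :
    MeasurableSet[sourcesSigma T X (pastSources k)] {ω | σ ω ≤ T k ω ∧ T k ω < 1} := by
  have hq : ∀ q : ℝ, ∃ B, MeasurableSet[sourcesSigma T X (pastSources k)] B ∧
      ∀ ω, T k ω ≤ q → q < T (k + 1) ω → (σ ω ≤ q ↔ ω ∈ B) := fun q => by
    obtain ⟨B, hB, hAB⟩ := h.exists_past_of_arrivalFiltration k (hσ.1 q)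
    refine ⟨B, hB, fun ω h1 h2 => ?_⟩
    rw [← hAB ω h1 h2]
    simp
  choose B hB hAB using hq
  set q : ℕ → Ω → ℝ := fun m ω => (⌊(m + 1 : ℝ) * T k ω⌋ + 1) / (m + 1 : ℝ) with hqd
  have hTk := h.measurable_epoch_past (le_refl k)
  have hm : ∀ m, MeasurableSet[sourcesSigma T X (pastSources k)] {ω | ω ∈ B (q m ω)} := fun m => by
    have e : {ω | ω ∈ B (q m ω)} = ⋃ i : ℤ, ((fun ω => ⌊(m + 1 : ℝ) * T k ω⌋) ⁻¹' {i} ∩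
        B ((i + 1) / (m + 1 : ℝ))) := by
      ext ω
      simp [hqd]
    rw [e]
    have hf : Measurable[sourcesSigma T X (pastSources k)] fun ω => ⌊(m + 1 : ℝ) * T k ω⌋ :=
      Int.measurable_floor.comp (hTk.const_mul _)
    exact MeasurableSet.iUnion fun i => (hf (measurableSet_singleton i)).inter (hB _)
  have e : {ω | σ ω ≤ T k ω ∧ T k ω < 1} =
      (⋃ N : ℕ, ⋂ m : ℕ, ⋂ _ : N ≤ m, {ω | ω ∈ B (q m ω)}) ∩ {ω | T k ω < 1} := by
    ext ω
    simp only [Set.mem_ofPred_eq, Set.mem_inter_iff, Set.mem_iUnion, Set.mem_iInter]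
    refine and_congr_left fun h1 => ?_
    have hlt : T k ω < T (k + 1) ω := h.strictMono_T ω (Nat.lt_succ_self k)
    have hε : 0 < min (T (k + 1) ω) 1 - T k ω := sub_pos.2 (lt_min hlt h1)
    obtain ⟨N, hN⟩ := exists_nat_one_div_lt hε
    have key : ∀ m, N ≤ m → (ω ∈ B (q m ω) ↔ σ ω ≤ T k ω) := fun m hNm => by
      have hm0 : (0 : ℝ) < m + 1 := by positivity
      have hq1 : T k ω ≤ q m ω := by
        rw [hqd]; simp only
        rw [le_div_iff₀ hm0, mul_comm]
        exact (Int.lt_floor_add_one _).le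
      have hq2 : q m ω ≤ T k ω + 1 / (m + 1 : ℝ) := by
        rw [hqd]; simp only
        rw [add_div]
        gcongr
        rw [div_le_iff₀ hm0, mul_comm]
        exact Int.floor_le _
      have hq3 : 1 / (m + 1 : ℝ) ≤ 1 / (N + 1 : ℝ) := by gcongr
      have hq4 : q m ω < min (T (k + 1) ω) 1 := by linarith
      obtain ⟨hq5, hq6⟩ := lt_min_iff.1 hq4
      rw [← hAB _ ω hq1 hq5]
      refine ⟨fun h2 => ?_, fun h2 => h2.trans hq1⟩
      rcases hσ.2 ω with h3 | ⟨i, -, -, h3⟩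
      · linarith
      · rw [h3] at h2 ⊢
        refine (h.strictMono_T ω).monotone ?_
        exact Nat.lt_succ_iff.1 ((h.strictMono_T ω).lt_iff_lt.1 (h2.trans_lt hq5))
    exact ⟨fun h2 => ⟨N, fun m hm => (key m hm).2 h2⟩,
      fun ⟨N', h2⟩ => (key (max N N') (le_max_left _ _)).1 (h2 _ (le_max_right _ _))⟩
  rw [e]
  exact (MeasurableSet.iUnion fun N => MeasurableSet.iInter fun m => MeasurableSet.iInter fun _ =>
    hm m).inter (hTk measurableSet_Iio)

lemma measurableSet_eq_epoch (h : IsMarkedPoisson P lam p T X) {σ : Ω → ℝ}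
    (hσ : IsStrategy T X h.measurable_T h.measurable_X σ) {k : ℕ} (hk : 1 ≤ k) :
    MeasurableSet[sourcesSigma T X (pastSources k)] {ω | σ ω = T k ω ∧ T k ω < 1} := by
  obtain ⟨m, rfl⟩ := Nat.exists_eq_add_of_le' hk
  have hsub : pastSources m ⊆ pastSources (m + 1) := fun i hi =>
    Nat.lt_succ_of_lt (show Sum.elim id id i < m from hi)
  have e : {ω | σ ω = T (m + 1) ω ∧ T (m + 1) ω < 1} =
      {ω | σ ω ≤ T (m + 1) ω ∧ T (m + 1) ω < 1} \ {ω | σ ω ≤ T m ω ∧ T m ω < 1} := by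
    ext ω
    have hlt : T m ω < T (m + 1) ω := h.strictMono_T ω (Nat.lt_succ_self m)
    simp only [Set.mem_ofPred_eq, Set.mem_sdiff]
    refine ⟨fun ⟨h1, h2⟩ => ⟨⟨h1.le, h2⟩, fun h3 => by linarith [h3.1]⟩, fun ⟨⟨h1, h2⟩, h3⟩ =>
      ⟨?_, h2⟩⟩
    rcases hσ.2 ω with h4 | ⟨i, -, -, h4⟩
    · linarith
    · rw [h4] at h1 h3 ⊢
      have h5 := (h.strictMono_T ω).le_iff_le.1 h1
      have h6 : m < i := by
        by_contra h6
        exact h3 ⟨(h.strictMono_T ω).monotone (not_lt.1 h6), by linarith⟩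
      rw [show i = m + 1 by omega]
  rw [e]
  exact (h.measurableSet_le_epoch hσ (m + 1)).diff
    (sourcesSigma_mono hsub _ (h.measurableSet_le_epoch hσ m))

end IsMarkedPoisson

end

/-! ### A telescoping identity for the winning probability -/

section
variable {Ω : Type*} {lam θ : ℝ} {p : ℕ → ℝ} {T : ℕ → Ω → ℝ} {X : ℕ → Ω → Bool}

/-- The event that `k ≥ 1` is a success before time `1` and that the strategy `σ` has not stopped at
a success with index at most `k`. A strategy that stops at a failure cannot win, and is regarded as
passing all later successes. -/
def passedSuccess (T : ℕ → Ω → ℝ) (X : ℕ → Ω → Bool) (σ : Ω → ℝ) (k : ℕ) : Set Ω :=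
  {ω | 1 ≤ k ∧ T k ω < 1 ∧ X k ω = true ∧
    ∀ i, 1 ≤ i → i ≤ k → X i ω = true → σ ω ≠ T i ω}

/-- If `k` is the last success, then exactly one success follows the penultimate one. -/
lemma exists_oneAfter_of_noneAfter {ω : Ω} {k : ℕ} (hk : 1 ≤ k)
    (h1 : T k ω < 1) (hX : X k ω = true) (h : ω ∈ noneAfter T X k) :
    ∃ i, i < k ∧ ω ∈ oneAfter T X i ∧ (i = 0 ∨ X i ω = true) := by
  classical
  -- `i` is the index of the penultimate success, or `0` if `k` is the only one.
  set i := Nat.findGreatest (fun i => X i ω = true) (k - 1) with hi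
  have hik : i ≤ k - 1 := Nat.findGreatest_le _
  refine ⟨i, by omega, ⟨k, by omega, h1, hX, fun n hn hn1 hne => ?_⟩, ?_⟩
  · rcases lt_or_gt_of_ne hne with hlt | hgt
    · simpa using Nat.findGreatest_is_greatest hn (show n ≤ k - 1 by omega)
    · exact h n hgt hn1
  · by_cases h0 : i = 0
    · exact Or.inl h0
    · exact Or.inr (Nat.findGreatest_of_ne_zero hi.symm h0)

lemma pairwise_disjoint_passedSuccess_inter_noneAfter (σ : Ω → ℝ) :
    Pairwise (Function.onFun Disjoint fun k => passedSuccess T X σ k ∩ noneAfter T X k) := by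
  intro i j hij
  refine Set.disjoint_left.2 fun ω hi hj => ?_
  rcases lt_or_gt_of_ne hij with hlt | hlt
  · simpa [hj.1.2.2.1] using hi.2 j hlt hj.1.2.1
  · simpa [hi.1.2.2.1] using hj.2 i hlt hi.1.2.1

variable [mΩ : MeasurableSpace Ω] {P : Measure Ω}

namespace IsMarkedPoisson

lemma measurableSet_passedSuccess (h : IsMarkedPoisson P lam p T X) {σ : Ω → ℝ}
    (hσ : IsStrategy T X h.measurable_T h.measurable_X σ) (k : ℕ) :
    MeasurableSet[sourcesSigma T X (pastSources k)] (passedSuccess T X σ k) := by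
  by_cases hk : 1 ≤ k
  · have hmono : ∀ i, i ≤ k → pastSources i ⊆ pastSources k := fun i hi j hj =>
      lt_of_lt_of_le (show Sum.elim id id j < i from hj) hi
    have e : passedSuccess T X σ k = {ω | T k ω < 1} ∩ {ω | X k ω = true} ∩
        ⋂ i ∈ Finset.Icc 1 k, ({ω | X i ω = true} ∩ {ω | σ ω = T i ω ∧ T i ω < 1})ᶜ := by
      ext ω
      simp only [passedSuccess, Set.mem_ofPred_eq, Set.mem_inter_iff, Set.mem_iInter,
        Set.mem_compl_iff, Finset.mem_Icc, not_and, hk, true_and, and_assoc, not_lt]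
      refine and_congr_right fun h1 => and_congr_right fun h2 =>
        ⟨fun H i hi hX h3 => absurd h3 (H i hi.1 hi.2 hX), fun H i hi hik hX h3 => ?_⟩
      have h4 := H i ⟨hi, hik⟩ hX h3
      have h5 : T i ω ≤ T k ω := (h.strictMono_T ω).monotone hik
      linarith
    rw [e]
    have m1 : MeasurableSet[sourcesSigma T X (pastSources k)] {ω | T k ω < 1} :=
      h.measurable_epoch_past le_rfl measurableSet_Iio
    have m2 : ∀ i, 1 ≤ i → i ≤ k →
        MeasurableSet[sourcesSigma T X (pastSources k)] {ω | X i ω = true} := fun i hi hik =>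
      measurable_mark_past hi hik (measurableSet_singleton true)
    refine (m1.inter (m2 k hk le_rfl)).inter (Finset.measurableSet_biInter _ fun i hi => ?_)
    obtain ⟨hi1, hi2⟩ := Finset.mem_Icc.1 hi
    exact ((m2 i hi1 hi2).inter
      (sourcesSigma_mono (hmono i hi2) _ (h.measurableSet_eq_epoch hσ hi1))).compl
  · have e : passedSuccess T X σ k = ∅ := by
      ext ω
      simp [passedSuccess, hk]
    rw [e]
    exact @MeasurableSet.empty _ (sourcesSigma T X (pastSources k))

/-- If `ℓ` is the last success and `i` the penultimate one (`i = 0` if there is none), then the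
strategy wins exactly if it passes `i` and does not pass `ℓ`. -/
lemma winEvent_union (h : IsMarkedPoisson P lam p T X) (σ : Ω → ℝ) :
    winEvent T X σ ∪ (⋃ k, passedSuccess T X σ k ∩ noneAfter T X k) =
      oneAfter T X 0 ∪ ⋃ k, passedSuccess T X σ k ∩ oneAfter T X k := by
  have hinj : ∀ ω i j, T i ω = T j ω → i = j := fun ω i j hij => (h.strictMono_T ω).injective hij
  apply Set.Subset.antisymm
  · rintro ω (⟨k, hk, h1, hσ, hX, hlast⟩ | hω)
    · have hnone : ω ∈ noneAfter T X k := fun n hn hn1 =>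
        hlast n (by omega) (by rw [hσ]; exact h.strictMono_T ω hn) hn1
      obtain ⟨i, hik, hi, h0⟩ := exists_oneAfter_of_noneAfter hk h1 hX hnone
      by_cases hi0 : i = 0
      · exact Or.inl (hi0 ▸ hi)
      · refine Or.inr (Set.mem_iUnion.2 ⟨i, ⟨by omega, ?_, h0.resolve_left hi0, ?_⟩, hi⟩)
        · exact (h.strictMono_T ω hik).trans h1
        · intro j _ hji _ hj
          have := hinj ω _ _ (hσ.symm.trans hj)
          omega
    · obtain ⟨k, ⟨hk, h1, hX, hpass⟩, hnone⟩ := Set.mem_iUnion.1 hω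
      obtain ⟨i, hik, hi, h0⟩ := exists_oneAfter_of_noneAfter hk h1 hX hnone
      by_cases hi0 : i = 0
      · exact Or.inl (hi0 ▸ hi)
      · exact Or.inr (Set.mem_iUnion.2 ⟨i, ⟨by omega, (h.strictMono_T ω hik).trans h1,
          h0.resolve_left hi0, fun j hj hji => hpass j hj (by omega)⟩, hi⟩)
  · intro ω hω
    obtain ⟨i, hpass, l, hil, hl1, hlX, hl⟩ : ∃ i, (∀ j, 1 ≤ j → j ≤ i → X j ω = true →
        σ ω ≠ T j ω) ∧ ω ∈ oneAfter T X i := by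
      rcases hω with hω | hω
      · exact ⟨0, fun j h1 h2 => by omega, hω⟩
      · obtain ⟨k, ⟨_, _, _, hpass⟩, hone⟩ := Set.mem_iUnion.1 hω
        exact ⟨k, hpass, hone⟩
    by_cases hs : σ ω = T l ω
    · refine Or.inl ⟨l, by omega, hl1, hs, hlX, fun n _ hn hn1 => ?_⟩
      rw [hs] at hn
      have hln : l < n := (h.strictMono_T ω).lt_iff_lt.1 hn
      exact hl n (by omega) hn1 (by omega)
    · refine Or.inr (Set.mem_iUnion.2 ⟨l, ⟨by omega, hl1, hlX, fun j hj hjl hjX hσj => ?_⟩,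
        fun n hn hn1 => hl n (by omega) hn1 (by omega)⟩)
      by_cases hji : j ≤ i
      · exact hpass j hj hji hjX hσj
      · by_cases hjl' : j = l
        · exact hs (hjl' ▸ hσj)
        · have hj1 : T j ω < 1 := ((h.strictMono_T ω).monotone hjl).trans_lt hl1
          simpa [hjX] using hl j (by omega) hj1 hjl'

/-- Every success that is passed exchanges the chance of being the last success for the chance of
being the penultimate one. The event `oneAfter T X 0` is that of exactly one success in all. -/
lemma measure_winEvent_add (h : IsMarkedPoisson P lam p T X) {σ : Ω → ℝ}
    (hσ : IsStrategy T X h.measurable_T h.measurable_X σ) :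
    P (winEvent T X σ) + ∑' k, P (passedSuccess T X σ k ∩ noneAfter T X k) =
      P (oneAfter T X 0) + ∑' k, P (passedSuccess T X σ k ∩ oneAfter T X k) := by
  have hm := fun k => h.sourcesSigma_le _ _ (h.measurableSet_passedSuccess hσ k)
  have hm0 := fun k => (hm k).inter (h.measurableSet_noneAfter k)
  have hm1 := fun k => (hm k).inter (h.measurableSet_oneAfter k)
  have hd : ∀ i j ω, i < j → ω ∈ passedSuccess T X σ j → ω ∈ oneAfter T X j →
      ω ∈ oneAfter T X i → False := by
    rintro i j ω hij ⟨hj, hj1, hjX, -⟩ ⟨l, hjl, hl1, hlX, -⟩ ⟨m, him, hm1, hmX, hm⟩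
    by_cases hjm : j = m
    · simpa [hlX] using hm l (by omega) hl1 (by omega)
    · simpa [hjX] using hm j hij hj1 hjm
  rw [← measure_iUnion _ hm0, ← measure_iUnion _ hm1,
    ← measure_union _ (MeasurableSet.iUnion hm0), ← measure_union _ (MeasurableSet.iUnion hm1),
    h.winEvent_union]
  · rw [Set.disjoint_left]
    intro ω h0 hω
    obtain ⟨k, hk, hone⟩ := Set.mem_iUnion.1 hω
    exact hd 0 k ω hk.1 hk hone h0
  · rw [Set.disjoint_left]
    rintro ω ⟨l, hl, hl1, hs, hlX, hlast⟩ hω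
    obtain ⟨k, ⟨hk, hk1, hkX, hpass⟩, hnone⟩ := Set.mem_iUnion.1 hω
    have hlk : ¬ l ≤ k := fun hlk => hpass l hl hlk hlX hs
    simpa [hlX] using hnone l (by omega) hl1
  · intro i j hij
    refine Set.disjoint_left.2 fun ω hi hj => ?_
    rcases lt_or_gt_of_ne hij with hlt | hlt
    · exact hd i j ω hlt hj.1 hj.2 hi.2
    · exact hd j i ω hlt hi.1 hi.2 hj.2
  · exact pairwise_disjoint_passedSuccess_inter_noneAfter σ

lemma tsum_measure_noneAfter_ne_top [IsProbabilityMeasure P] (h : IsMarkedPoisson P lam p T X)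
    {σ : Ω → ℝ} (hσ : IsStrategy T X h.measurable_T h.measurable_X σ) :
    ∑' k, P (passedSuccess T X σ k ∩ noneAfter T X k) ≠ ⊤ := by
  have hm0 := fun k => (h.sourcesSigma_le _ _ (h.measurableSet_passedSuccess hσ k)).inter
    (h.measurableSet_noneAfter k)
  rw [← measure_iUnion _ hm0]
  · exact measure_ne_top P _
  · exact pairwise_disjoint_passedSuccess_inter_noneAfter σ

end IsMarkedPoisson

end

/-! ### Optimality of the threshold rule -/

section
variable {Ω : Type*} {lam θ : ℝ} {p : ℕ → ℝ} {T : ℕ → Ω → ℝ} {X : ℕ → Ω → Bool}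

lemma markovRule_congr (h0 : ∀ ω, T 0 ω = 0) (hT : ∀ ω, StrictMono fun n => T n ω)
    {A B : Set (ℝ × ℕ)} (h : ∀ t ∈ Set.Icc (0 : ℝ) 1, ∀ k, 1 ≤ k → ((t, k) ∈ A ↔ (t, k) ∈ B)) :
    markovRule T X A = markovRule T X B := by
  classical
  ext ω
  have e : ∀ k, (1 ≤ k ∧ T k ω < 1 ∧ X k ω = true ∧ (T k ω, k) ∈ A) ↔
      (1 ≤ k ∧ T k ω < 1 ∧ X k ω = true ∧ (T k ω, k) ∈ B) := fun k => by
    refine and_congr_right fun hk => and_congr_right fun h1 => and_congr_right fun _ =>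
      h _ ⟨?_, h1.le⟩ k hk
    rw [← h0 ω]
    exact (hT ω).monotone (Nat.zero_le k)
  have e' : {k | 1 ≤ k ∧ T k ω < 1 ∧ X k ω = true ∧ (T k ω, k) ∈ A} =
      {k | 1 ≤ k ∧ T k ω < 1 ∧ X k ω = true ∧ (T k ω, k) ∈ B} := Set.ext e
  unfold markovRule
  rw [e']
  exact if_congr (exists_congr e) rfl rfl

/-- The Markovian rule either stops at a first success in the stopping set, or does not stop because
there is no such success. -/
lemma markovRule_spec (T : ℕ → Ω → ℝ) (X : ℕ → Ω → Bool) (A : Set (ℝ × ℕ)) (ω : Ω) :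
    (∃ m, (1 ≤ m ∧ T m ω < 1 ∧ X m ω = true ∧ (T m ω, m) ∈ A) ∧
      (∀ k, 1 ≤ k → T k ω < 1 → X k ω = true → (T k ω, k) ∈ A → m ≤ k) ∧
      markovRule T X A ω = T m ω) ∨
    ((∀ k, 1 ≤ k → T k ω < 1 → X k ω = true → (T k ω, k) ∉ A) ∧ markovRule T X A ω = 1) := by
  classical
  by_cases h : ∃ k : ℕ, 1 ≤ k ∧ T k ω < 1 ∧ X k ω = true ∧ (T k ω, k) ∈ A
  · refine Or.inl ⟨sInf {k : ℕ | 1 ≤ k ∧ T k ω < 1 ∧ X k ω = true ∧ (T k ω, k) ∈ A},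
      Nat.sInf_mem h, fun k h1 h2 h3 h4 => Nat.sInf_le ⟨h1, h2, h3, h4⟩, ?_⟩
    rw [markovRule, if_pos h]
  · refine Or.inr ⟨fun k h1 h2 h3 h4 => h ⟨k, h1, h2, h3, h4⟩, ?_⟩
    rw [markovRule, if_neg h]

/-- The stopping set `{(t, k) | (1 - t) * lam ≤ γ k}`. -/
def thresholdSet (lam : ℝ) (γ : ℕ → ℝ) : Set (ℝ × ℕ) := {q | (1 - q.1) * lam ≤ γ q.2}

/-- For increasing thresholds the stopping set is never left, so that the rule passes a success
exactly if that success lies outside the stopping set. -/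
lemma passedSuccess_markovRule (hT : ∀ ω, StrictMono fun n => T n ω) (hlam : 0 < lam) {γ : ℕ → ℝ}
    (hγ : ∀ k, 1 ≤ k → γ k < γ (k + 1)) (k : ℕ) :
    passedSuccess T X (markovRule T X (thresholdSet lam γ)) k =
      {ω | 1 ≤ k ∧ T k ω < 1 ∧ X k ω = true ∧ ¬ (1 - T k ω) * lam ≤ γ k} := by
  have hγm : ∀ i j, 1 ≤ i → i ≤ j → γ i ≤ γ j := fun i j hi hij => by
    induction j, hij using Nat.le_induction with
    | base => exact le_rfl
    | succ j hij ih => exact ih.trans (hγ j (hi.trans hij)).le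
  ext ω
  refine and_congr_right fun hk => and_congr_right fun h1 => and_congr_right fun hX => ?_
  rcases markovRule_spec T X (thresholdSet lam γ) ω with
    ⟨m, ⟨hm, hm1, hmX, hmA⟩, hmin, hτ⟩ | ⟨hno, hτ⟩
  · rw [hτ]
    constructor
    · intro H hA
      exact H m hm (hmin k hk h1 hX hA) hmX rfl
    · intro H i hi hik _ hmi
      obtain rfl : m = i := (hT ω).injective hmi
      refine H (le_trans ?_ (le_trans hmA (hγm m k hm hik)))
      have : T m ω ≤ T k ω := (hT ω).monotone hik
      simp only
      gcongr
  · rw [hτ]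
    refine iff_of_true (fun i _ hik _ hi => ?_) (hno k hk h1 hX)
    have : T i ω ≤ T k ω := (hT ω).monotone hik
    linarith

variable [mΩ : MeasurableSpace Ω] {P : Measure Ω}

namespace IsMarkedPoisson

lemma isStrategy_markovRule (h : IsMarkedPoisson P lam p T X) (hlam : 0 < lam) (γ : ℕ → ℝ) :
    IsStrategy T X h.measurable_T h.measurable_X (markovRule T X (thresholdSet lam γ)) := by
  have hspec := markovRule_spec T X (thresholdSet lam γ)
  refine ⟨fun t => ?_, fun ω => ?_⟩
  · by_cases ht : 1 ≤ t
    · have e : {ω | ((markovRule T X (thresholdSet lam γ) ω : ℝ) : WithTop ℝ) ≤ t} = Set.univ := by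
        ext ω
        simp only [Set.mem_ofPred_eq, WithTop.coe_le_coe, Set.mem_univ, iff_true]
        rcases hspec ω with ⟨m, ⟨_, hm1, _⟩, _, hτ⟩ | ⟨_, hτ⟩ <;> rw [hτ] <;> linarith
      rw [e]
      exact @MeasurableSet.univ _ (arrivalFiltration T X h.measurable_T h.measurable_X t)
    · have gen : ∀ n, 1 ≤ n → ∀ s ≤ t,
          MeasurableSet[arrivalFiltration T X h.measurable_T h.measurable_X t] {ω | T n ω ≤ s} :=
        fun n hn s hs => MeasurableSpace.measurableSet_generateFrom ⟨n, hn, s, hs, Or.inl rfl⟩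
      have gen' : ∀ n, 1 ≤ n →
          MeasurableSet[arrivalFiltration T X h.measurable_T h.measurable_X t]
            {ω | T n ω ≤ t ∧ X n ω = true} :=
        fun n hn => MeasurableSpace.measurableSet_generateFrom ⟨n, hn, t, le_rfl, Or.inr rfl⟩
      have e : {ω | ((markovRule T X (thresholdSet lam γ) ω : ℝ) : WithTop ℝ) ≤ t} =
          ⋃ n : ℕ, ⋃ _ : 1 ≤ n ∧ 1 - γ n / lam ≤ t, ({ω | T n ω ≤ t ∧ X n ω = true} \
            ⋃ m : ℕ, {ω | T n ω ≤ 1 - γ n / lam - 1 / (m + 1 : ℝ)}) := by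
        ext ω
        have hA : ∀ n, (T n ω, n) ∈ thresholdSet lam γ ↔ 1 - γ n / lam ≤ T n ω := fun n => by
          rw [thresholdSet, Set.mem_ofPred_eq, ← le_div_iff₀ hlam]
          constructor <;> intro h <;> linarith
        have hU : ∀ n, (¬ ∃ m : ℕ, T n ω ≤ 1 - γ n / lam - 1 / (m + 1 : ℝ)) ↔
            1 - γ n / lam ≤ T n ω := fun n => by
          simp only [not_exists, not_le]
          refine ⟨fun H => ?_, fun H m => ?_⟩
          · by_contra hlt
            obtain ⟨m, hm⟩ := exists_nat_one_div_lt (sub_pos.2 (not_le.1 hlt))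
            have := H m
            linarith
          · have : 0 < 1 / (m + 1 : ℝ) := by positivity
            linarith
        simp only [Set.mem_iUnion, Set.mem_sdiff, exists_prop, Set.mem_ofPred_eq, hU,
          WithTop.coe_le_coe]
        constructor
        · intro hle
          rcases hspec ω with ⟨m, ⟨hm, hm1, hmX, hmA⟩, _, hτ⟩ | ⟨_, hτ⟩
          · rw [hτ] at hle
            exact ⟨m, ⟨hm, ((hA m).1 hmA).trans hle⟩, ⟨hle, hmX⟩, (hA m).1 hmA⟩
          · linarith
        · rintro ⟨n, ⟨hn, -⟩, ⟨hle, hnX⟩, hnA⟩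
          have hn1 : T n ω < 1 := by linarith
          rcases hspec ω with ⟨m, _, hmin, hτ⟩ | ⟨hno, _⟩
          · rw [hτ]
            exact ((h.strictMono_T ω).monotone (hmin n hn hn1 hnX ((hA n).2 hnA))).trans hle
          · exact absurd ((hA n).2 hnA) (hno n hn hn1 hnX)
      rw [e]
      refine MeasurableSet.iUnion fun n => MeasurableSet.iUnion fun hn =>
        (gen' n hn.1).diff (MeasurableSet.iUnion fun m => gen n hn.1 _ ?_)
      have : 0 < 1 / (m + 1 : ℝ) := by positivity
      linarith [hn.2]
  · rcases hspec ω with ⟨m, ⟨hm, hm1, _⟩, _, hτ⟩ | ⟨_, hτ⟩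
    · exact Or.inr ⟨m, hm, hm1.le, hτ⟩
    · exact Or.inl hτ

variable [IsProbabilityMeasure P]

/-- Passing a success gains `S₁ - S₀` in conditional expectation. The threshold rule passes exactly
those successes where this is positive, so it gains most at every index. -/
lemma gain_le (h : IsMarkedPoisson P lam (ksProfile θ) T X) (hθ : 0 < θ) (hlam : 0 < lam)
    {γ : ℕ → ℝ} (hγ : ∀ k, 1 ≤ k → IsCriticalRoot θ k (γ k))
    {σ : Ω → ℝ} (hσ : IsStrategy T X h.measurable_T h.measurable_X σ) (k : ℕ) :
    P (passedSuccess T X σ k ∩ oneAfter T X k) +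
        P (passedSuccess T X (markovRule T X (thresholdSet lam γ)) k ∩ noneAfter T X k) ≤
      P (passedSuccess T X (markovRule T X (thresholdSet lam γ)) k ∩ oneAfter T X k) +
        P (passedSuccess T X σ k ∩ noneAfter T X k) := by
  set τ := markovRule T X (thresholdSet lam γ) with hτd
  have hτ : IsStrategy T X h.measurable_T h.measurable_X τ := h.isStrategy_markovRule hlam γ
  by_cases hk : 1 ≤ k
  swap
  · simp [passedSuccess, hk]
  have hpast := h.measurableSet_passedSuccess hσ k
  have hpast' := h.measurableSet_passedSuccess hτ k
  have hm := h.sourcesSigma_le _ _ hpast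
  have hm' := h.sourcesSigma_le _ _ hpast'
  have hf : Measurable fun ω =>
      ENNReal.ofReal (S0 (poissonPrior lam) (ksProfile θ) (T k ω) k) := by
    have := h.measurable_T k
    have := (continuous_kumM hθ hk).measurable
    simp only [S0_eq hθ hk hlam]
    fun_prop
  have hg : Measurable fun ω =>
      ENNReal.ofReal (S1 (poissonPrior lam) (ksProfile θ) (T k ω) k) := by
    have := h.measurable_T k
    have := (continuous_kumN hθ hk).measurable
    simp only [S1_eq hθ hk hlam]
    fun_prop
  rw [h.measure_inter_oneAfter hθ hlam hk hpast fun ω hω => hω.2.1,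
    h.measure_inter_oneAfter hθ hlam hk hpast' fun ω hω => hω.2.1,
    h.measure_inter_noneAfter hθ hlam hk hpast fun ω hω => hω.2.1,
    h.measure_inter_noneAfter hθ hlam hk hpast' fun ω hω => hω.2.1,
    ← lintegral_indicator hm, ← lintegral_indicator hm', ← lintegral_indicator hm,
    ← lintegral_indicator hm', ← lintegral_add_left (hg.indicator hm),
    ← lintegral_add_left (hg.indicator hm')]
  refine lintegral_mono fun ω => ?_
  have hmem : ω ∈ passedSuccess T X τ k ↔
      1 ≤ k ∧ T k ω < 1 ∧ X k ω = true ∧ ¬ (1 - T k ω) * lam ≤ γ k := by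
    rw [hτd, passedSuccess_markovRule h.strictMono_T hlam fun i hi =>
      isCriticalRoot_lt_succ hθ hi (hγ i hi) (hγ (i + 1) (by omega))]
    rfl
  by_cases hω : ω ∈ passedSuccess T X σ k <;> by_cases hω' : ω ∈ passedSuccess T X τ k
  · simp [hω, hω']
  · simp only [hω, hω', Set.indicator_of_mem, Set.indicator_of_notMem, not_false_eq_true,
      add_zero, zero_add]
    have hle : (1 - T k ω) * lam ≤ γ k := by
      by_contra hlt
      exact hω' (hmem.2 ⟨hk, hω.2.1, hω.2.2.1, hlt⟩)
    exact ENNReal.ofReal_le_ofReal ((mem_myopicSet_iff hθ hk hlam (hγ k hk) hω.2.1.le).2 hle)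
  · simp only [hω, hω', Set.indicator_of_mem, Set.indicator_of_notMem, not_false_eq_true,
      add_zero, zero_add]
    obtain ⟨-, h1, -, hlt⟩ := hmem.1 hω'
    refine ENNReal.ofReal_le_ofReal (le_of_lt (not_le.1 fun hle => hlt ?_))
    exact (mem_myopicSet_iff hθ hk hlam (hγ k hk) h1.le).1 hle
  · simp [hω, hω']

lemma isOptimal_markovRule (h : IsMarkedPoisson P lam (ksProfile θ) T X) (hθ : 0 < θ)
    (hlam : 0 < lam) {γ : ℕ → ℝ} (hγ : ∀ k, 1 ≤ k → IsCriticalRoot θ k (γ k)) :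
    IsOptimal P T X h.measurable_T h.measurable_X (markovRule T X (thresholdSet lam γ)) := by
  have hτ := h.isStrategy_markovRule hlam γ
  refine ⟨hτ, fun σ hσ => ?_⟩
  set τ := markovRule T X (thresholdSet lam γ)
  have eσ := h.measure_winEvent_add hσ
  have eτ := h.measure_winEvent_add hτ
  have hle := ENNReal.tsum_le_tsum (h.gain_le hθ hlam hγ hσ)
  rw [ENNReal.tsum_add, ENNReal.tsum_add] at hle
  have hne := h.tsum_measure_noneAfter_ne_top hσ
  have hne' := h.tsum_measure_noneAfter_ne_top hτ
  refine (ENNReal.add_le_add_iff_right (ENNReal.add_ne_top.2 ⟨hne, hne'⟩)).1 ?_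
  rw [← add_assoc, eσ, add_comm (∑' k, P (passedSuccess T X σ k ∩ noneAfter T X k)), ← add_assoc,
    eτ, add_assoc, add_assoc]
  exact add_le_add_right hle _

end IsMarkedPoisson

end

end LastSuccess

theorem mainTheorem2 (θ : ℝ) (hθ : 0 < θ) :
    (∀ k : ℕ, 1 ≤ k → ∃! x : ℝ, LastSuccess.IsCriticalRoot θ k x) ∧
    ∀ γ : ℕ → ℝ, (∀ k : ℕ, 1 ≤ k → LastSuccess.IsCriticalRoot θ k (γ k)) →
      (∀ k : ℕ, 1 ≤ k → γ k < γ (k + 1)) ∧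
      ∀ lam : ℝ, 0 < lam →
        (∀ t ∈ Set.Icc (0 : ℝ) 1, ∀ k : ℕ, 1 ≤ k →
          ((t, k) ∈ LastSuccess.myopicSet (LastSuccess.poissonPrior lam) (LastSuccess.ksProfile θ) ↔
            (1 - t) * lam ≤ γ k)) ∧
        ∀ (Ω : Type*) [MeasurableSpace Ω] (P : MeasureTheory.Measure Ω)
          [MeasureTheory.IsProbabilityMeasure P] (T : ℕ → Ω → ℝ) (X : ℕ → Ω → Bool)
          (h : LastSuccess.IsMarkedPoisson P lam (LastSuccess.ksProfile θ) T X),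
          LastSuccess.markovRule T X
              (LastSuccess.myopicSet (LastSuccess.poissonPrior lam) (LastSuccess.ksProfile θ)) =
            LastSuccess.markovRule T X {q : ℝ × ℕ | (1 - q.1) * lam ≤ γ q.2} ∧
          LastSuccess.IsOptimal P T X h.measurable_T h.measurable_X
            (LastSuccess.markovRule T X {q : ℝ × ℕ | (1 - q.1) * lam ≤ γ q.2}) := by
  refine ⟨fun k hk => LastSuccess.existsUnique_isCriticalRoot hθ hk, fun γ hγ =>
    ⟨fun k hk => LastSuccess.isCriticalRoot_lt_succ hθ hk (hγ k hk) (hγ (k + 1) (by omega)),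
      fun lam hlam => ?_⟩⟩
  have hiff : ∀ t ∈ Set.Icc (0 : ℝ) 1, ∀ k : ℕ, 1 ≤ k →
      ((t, k) ∈ LastSuccess.myopicSet (LastSuccess.poissonPrior lam) (LastSuccess.ksProfile θ) ↔
        (1 - t) * lam ≤ γ k) := fun t ht k hk =>
    LastSuccess.mem_myopicSet_iff hθ hk hlam (hγ k hk) ht.2
  exact ⟨hiff, fun Ω _ P _ T X h => ⟨LastSuccess.markovRule_congr h.T_zero h.strictMono_T hiff,
    h.isOptimal_markovRule hθ hlam hγ⟩⟩
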